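/- Let $d\ge 2$. For a bounded measurable $V:\mathbb{R}^d\to\mathbb{C}$ let $H_V=-\Delta+V$ be the Schrödinger operator in $L^2(\mathbb{R}^d)$ with domain $H^2(\mathbb{R}^d)$. For $\varepsilon>0$ let $z_\varepsilon=1+i\varepsilon$, and let $\chi_\varepsilon$ be the indicator function of the tube $$T_\varepsilon=\{x=(x_1,x')\in\mathbb{R}\times\mathbb{R}^{d-1}:\ |x_1|<\varepsilon^{-1},\ |x'|<\varepsilon^{-1/2}\}.$$ (1) There is a family $(V_\varepsilon)_{\varepsilon>0}$ of measurable functions $V_\varepsilon:\mathbb{R}^d\to\mathbb{C}$ with the following properties. (a) For every $M>0$ there is a constant $C=C(d,M)$ such that $|V_\varepsilon|\le C\,\varepsilon\,\chi_\varepsilon$ on $\mathbb{R}^d$ for all $0<\varepsilon\le M$. (b) For every $\varepsilon>0$, $z_\varepsilon$ is an eigenvalue of $H_{V_\varepsilon}$. (c) For every real $q>(d+1)/2$, $$\limsup_{\varepsilon\to0^+}\frac{|z_\varepsilon|^{q-\frac d2}}{\|V_\varepsilon\|_q^q}=+\infty .$$ (2) Consequently, for every $\gamma>1/2$ there is no constant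 $D$ such that $$|z|^\gamma\le D\int_{\mathbb{R}^d}|V(x)|^{\gamma+\frac d2}\,dx$$ for all complex-valued $V\in L^\infty(\mathbb{R}^d)\cap L^{\gamma+d/2}(\mathbb{R}^d)$ and all eigenvalues $z\in\mathbb{C}\setminus[0,\infty)$ of $H_V$. In particular the Laptev–Safronov conjecture, which asserts such a bound for $0<\gamma\le d/2$, fails for $1/2<\gamma\le d/2$, the range not covered by Frank's theorem. -/

import Mathlib

open MeasureTheory Filter Topology TemperedDistribution
open scoped SchwartzMap Laplacian ENNReal

noncomputable section

/-- Two `L²` functions that define the same tempered distribution are equal. -/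
theorem lp_eq_of_distribution_eq {d : ℕ}
    {f g : Lp ℂ 2 (volume : Measure (EuclideanSpace ℝ (Fin d)))}
    (h : (f : 𝓢'(EuclideanSpace ℝ (Fin d), ℂ)) = g) : f = g := by
  have hk := Lp.ker_toTemperedDistributionCLM_eq_bot (E := EuclideanSpace ℝ (Fin d)) (F := ℂ)
    (p := 2) (μ := volume)
  exact LinearMap.ker_eq_bot.mp hk h

/-- The subspace `H²(ℝᵈ)` of `L²(ℝᵈ)`. -/
def sobolevH2 (d : ℕ) :
    Submodule ℂ (Lp ℂ 2 (volume : Measure (EuclideanSpace ℝ (Fin d)))) where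
  carrier := {u | MemSobolev 2 2 (u : 𝓢'(EuclideanSpace ℝ (Fin d), ℂ))}
  add_mem' := by
    intro u v hu hv
    have h := MemSobolev.add hu hv
    simp only [← Lp.toTemperedDistributionCLM_apply, ← map_add] at h
    exact h
  zero_mem' := by
    have h := memSobolev_fun_zero (EuclideanSpace ℝ (Fin d)) ℂ 2 2
    rw [← map_zero (Lp.toTemperedDistributionCLM ℂ (volume : Measure (EuclideanSpace ℝ (Fin d)))
      2)] at h
    exact h
  smul_mem' := by
    intro c u hu
    have h := MemSobolev.smul c hu
    simp only [← Lp.toTemperedDistributionCLM_apply, ← map_smul] at h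
    exact h

theorem exists_neg_laplacian {d : ℕ} (u : sobolevH2 d) :
    ∃ w : Lp ℂ 2 (volume : Measure (EuclideanSpace ℝ (Fin d))),
      (w : 𝓢'(EuclideanSpace ℝ (Fin d), ℂ)) =
        -Δ ((u : Lp ℂ 2 (volume : Measure (EuclideanSpace ℝ (Fin d)))) :
          𝓢'(EuclideanSpace ℝ (Fin d), ℂ)) := by
  have h := MemSobolev.laplacian u.2
  norm_num at h
  obtain ⟨w, hw⟩ := memSobolev_zero_iff.mp h.neg
  exact ⟨w, hw.symm⟩

/-- The operator `-Δ` in `L²(ℝᵈ)` with domain `H²(ℝᵈ)`; `-Δ u` is the `L²` function that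
represents the distribution `-Δ u`. -/
def negLaplacian (d : ℕ) :
    Lp ℂ 2 (volume : Measure (EuclideanSpace ℝ (Fin d))) →ₗ.[ℂ]
      Lp ℂ 2 (volume : Measure (EuclideanSpace ℝ (Fin d))) where
  domain := sobolevH2 d
  toFun :=
    { toFun := fun u => (exists_neg_laplacian u).choose
      map_add' := by
        intro u v
        apply lp_eq_of_distribution_eq
        have h := (exists_neg_laplacian (u + v)).choose_spec
        have hu := (exists_neg_laplacian u).choose_spec
        have hv := (exists_neg_laplacian v).choose_spec
        rw [h]
        simp only [← Lp.toTemperedDistributionCLM_apply, map_add, Submodule.coe_add,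
          ← laplacianCLM_apply] at hu hv ⊢
        rw [hu, hv, neg_add]
      map_smul' := by
        intro c u
        apply lp_eq_of_distribution_eq
        have h := (exists_neg_laplacian (c • u)).choose_spec
        have hu := (exists_neg_laplacian u).choose_spec
        rw [h]
        simp only [← Lp.toTemperedDistributionCLM_apply, map_smul, Submodule.coe_smul,
          ← laplacianCLM_apply, RingHom.id_apply] at hu ⊢
        rw [hu, smul_neg] }

/-- The maximal domain of multiplication by `V` in `L²(ℝᵈ)`: all `u ∈ L²` with `V u ∈ L²`. -/
def mulDomain {d : ℕ} (V : EuclideanSpace ℝ (Fin d) → ℂ) :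
    Submodule ℂ (Lp ℂ 2 (volume : Measure (EuclideanSpace ℝ (Fin d)))) where
  carrier := {u | MemLp (fun x => V x * u x) 2 volume}
  add_mem' := by
    intro u v hu hv
    refine (memLp_congr_ae ?_).mp (MemLp.add hu hv)
    filter_upwards [Lp.coeFn_add u v] with x hx
    show V x * u x + V x * v x = V x * (u + v : Lp ℂ 2 _) x
    rw [hx, Pi.add_apply, mul_add]
  zero_mem' := by
    refine (memLp_congr_ae ?_).mp (MemLp.zero (ε := ℂ))
    filter_upwards [Lp.coeFn_zero ℂ 2 (volume : Measure (EuclideanSpace ℝ (Fin d)))] with x hx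
    show (0 : ℂ) = V x * (0 : Lp ℂ 2 _) x
    rw [hx, Pi.zero_apply, mul_zero]
  smul_mem' := by
    intro c u hu
    refine (memLp_congr_ae ?_).mp (MemLp.const_smul hu c)
    filter_upwards [Lp.coeFn_smul c u] with x hx
    show c * (V x * u x) = V x * (c • u : Lp ℂ 2 _) x
    rw [hx, Pi.smul_apply, smul_eq_mul, mul_left_comm]

theorem memLp_of_mem_mulDomain {d : ℕ} {V : EuclideanSpace ℝ (Fin d) → ℂ}
    {u : Lp ℂ 2 (volume : Measure (EuclideanSpace ℝ (Fin d)))} (hu : u ∈ mulDomain V) :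
    MemLp (fun x => V x * u x) 2 volume := hu

/-- Multiplication by `V` in `L²(ℝᵈ)`, on its maximal domain (all of `L²` for bounded
measurable `V`). -/
def mulPotential {d : ℕ} (V : EuclideanSpace ℝ (Fin d) → ℂ) :
    Lp ℂ 2 (volume : Measure (EuclideanSpace ℝ (Fin d))) →ₗ.[ℂ]
      Lp ℂ 2 (volume : Measure (EuclideanSpace ℝ (Fin d))) where
  domain := mulDomain V
  toFun :=
    { toFun := fun u => MemLp.toLp _ (memLp_of_mem_mulDomain u.2)
      map_add' := by
        intro u v
        apply Lp.ext
        filter_upwards [Lp.coeFn_add u.1 v.1, MemLp.coeFn_toLp (memLp_of_mem_mulDomain u.2),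
          MemLp.coeFn_toLp (memLp_of_mem_mulDomain v.2),
          MemLp.coeFn_toLp (memLp_of_mem_mulDomain (u + v).2),
          Lp.coeFn_add (MemLp.toLp _ (memLp_of_mem_mulDomain u.2))
            (MemLp.toLp _ (memLp_of_mem_mulDomain v.2))] with x h1 h2 h3 h4 h5
        rw [h4, h5, Pi.add_apply, h2, h3, Submodule.coe_add, h1, Pi.add_apply, mul_add]
      map_smul' := by
        intro c u
        apply Lp.ext
        filter_upwards [Lp.coeFn_smul c u.1, MemLp.coeFn_toLp (memLp_of_mem_mulDomain u.2),
          MemLp.coeFn_toLp (memLp_of_mem_mulDomain (c • u).2),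
          Lp.coeFn_smul c (MemLp.toLp _ (memLp_of_mem_mulDomain u.2))] with x h1 h2 h3 h4
        rw [RingHom.id_apply, h3, h4, Pi.smul_apply, h2, Submodule.coe_smul, h1, Pi.smul_apply,
          smul_eq_mul, smul_eq_mul, mul_left_comm] }

/-- The Schrödinger operator `H_V = -Δ + V` in `L²(ℝᵈ)`. For bounded measurable `V` its domain
is `H²(ℝᵈ)`. -/
def schrodinger {d : ℕ} (V : EuclideanSpace ℝ (Fin d) → ℂ) :
    Lp ℂ 2 (volume : Measure (EuclideanSpace ℝ (Fin d))) →ₗ.[ℂ]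
      Lp ℂ 2 (volume : Measure (EuclideanSpace ℝ (Fin d))) :=
  negLaplacian d + mulPotential V

/-- `z` is an eigenvalue of `H_V`. -/
def IsSchrodingerEigenvalue {d : ℕ} (V : EuclideanSpace ℝ (Fin d) → ℂ) (z : ℂ) : Prop :=
  ∃ ψ : (schrodinger V).domain,
    ψ ≠ 0 ∧ schrodinger V ψ = z • (ψ : Lp ℂ 2 (volume : Measure (EuclideanSpace ℝ (Fin d))))

/-- The tube `{x = (x₁, x') ∈ ℝ × ℝᵈ⁻¹ : |x₁| < ε⁻¹, |x'| < ε^(-1/2)}`; the coordinate `x₁` is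
the one with index `0`, and `|x'|` is the Euclidean norm of the others. -/
def tube (d : ℕ) (ε : ℝ) : Set (EuclideanSpace ℝ (Fin d)) :=
  {x | (∀ i : Fin d, i.val = 0 → |x i| < ε⁻¹) ∧
    √(∑ i : Fin d with i.val ≠ 0, x i ^ 2) < ε ^ (-(1 / 2) : ℝ)}

/-- The Laptev–Safronov bound with exponent `γ` in dimension `d`, for bounded potentials:
there is a constant `D` such that `|z|^γ ≤ D ∫ |V|^(γ + d/2)` for all
`V ∈ L^∞ ∩ L^(γ + d/2)` and all eigenvalues `z ∈ ℂ \ [0, ∞)` of `-Δ + V`. -/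
def LaptevSafronovBound (d : ℕ) (γ : ℝ) : Prop :=
  ∃ D : ℝ, ∀ (V : EuclideanSpace ℝ (Fin d) → ℂ) (z : ℂ),
    MemLp V ∞ volume → MemLp V (ENNReal.ofReal (γ + d / 2)) volume →
    (∀ r : ℝ, 0 ≤ r → z ≠ r) → IsSchrodingerEigenvalue V z →
    ‖z‖ ^ γ ≤ D * ∫ x, ‖V x‖ ^ (γ + d / 2)

end

/-! Write `R` for the free resolvent at `z = 1 + iε`, `χ` for the indicator of the tube and `K =
χRχ`. The tube has the natural shape of a wave packet `φ(x) = e^(i x₁) g(εx₁, √ε x')`: the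
oscillation cancels the real part 1 of `z`, and every remaining term of `(-Δ - z)φ` carries a factor
`ε`. If `g` is supported in the unit ball, `φ` and `(-Δ - z)φ` live in the tube, so `K(-Δ - z)φ = φ`
and `‖K‖ ≥ 1/(Cε)` (`exists_approximate_eigenfunction`,
`exists_one_le_mul_norm_compressedResolvent_tube`).

The large norm is turned into an eigenvalue by complex symmetry. `K` is compact and symmetric for
the bilinear form `∫ f g`, so Takagi's theorem (`exists_apply_eq_norm_smul_conj`) gives `f ≠ 0` with
`K f = σ f̄`, `σ = ‖K‖`. Then `f` lives in the tube, and `ψ = R f` equals `σ f̄` there. The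
potential `V = -f / (σ f̄)` on the tube satisfies `Vψ = -f`, that is `(-Δ + V)ψ = zψ`, and has
constant modulus `1/σ ≤ Cε` (`exists_potential_of_compressedResolvent_ne_zero`).

The tube has volume of order at most `ε^(-(d+1)/2)`, so `∫|V|^q` is at most of order `ε^(q-(d+1)/2)`
and tends to 0 when `q > (d+1)/2`, while `|z| ≥ 1`. This gives the blow-up, and with `q = γ + d/2`
it rules out every constant `D`. -/

noncomputable section

/-! ### Compact operators on Hilbert space: Hilbert–Schmidt criterion and Takagi's theorem. -/

/-- A bounded operator with summable squared norms on a Hilbert basis is compact. -/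
theorem isCompactOperator_of_summable_norm_sq {ι H H' : Type*} [NormedAddCommGroup H]
    [InnerProductSpace ℂ H] [NormedAddCommGroup H'] [InnerProductSpace ℂ H'] [CompleteSpace H']
    (b : HilbertBasis ι ℂ H) (T : H →L[ℂ] H') (h : Summable fun i => ‖T (b i)‖ ^ 2) :
    IsCompactOperator T := by
  -- Finite-rank truncations of `T` along the basis; they converge to `T` in norm because the tails
  -- are controlled by Cauchy–Schwarz and Bessel's inequality.
  let F : Finset ι → H →L[ℂ] H' := fun s =>
    ∑ i ∈ s, (innerSL ℂ (b i)).smulRight (T (b i))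
  have hFc : ∀ s, IsCompactOperator (F s) := by
    intro s
    have h1 : ∀ i, IsCompactOperator ((innerSL ℂ (b i)).smulRight (T (b i))) := fun i =>
      (isCompactOperator_of_locallyCompactSpace_rng (ContinuousLinearMap.toSpanSingleton ℂ
        (T (b i)))).comp_clm (innerSL ℂ (b i))
    classical
    induction s using Finset.induction_on with
    | empty =>
      simp only [F, Finset.sum_empty]
      exact isCompactOperator_zero
    | insert i s hi ih =>
      simp only [F, Finset.sum_insert hi]
      exact (h1 i).add ih
  refine isCompactOperator_of_tendsto (l := atTop) (F := F) ?_ (Eventually.of_forall hFc)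
  rw [tendsto_iff_norm_sub_tendsto_zero]
  rw [Metric.tendsto_nhds]
  intro δ hδ
  have hv := summable_iff_vanishing_norm.1 h ((δ / 2) ^ 2) (by positivity)
  obtain ⟨s, hs⟩ := hv
  filter_upwards [eventually_ge_atTop s] with t ht
  rw [dist_zero_right, norm_norm]
  refine lt_of_le_of_lt (ContinuousLinearMap.opNorm_le_bound _ (by positivity : 0 ≤ δ / 2) ?_)
    (half_lt_self hδ)
  intro x
  have hlim : Tendsto (fun u => F u x) atTop (𝓝 (T x)) := by
    have h1 := (b.hasSum_repr x).mapL T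
    refine h1.congr fun u => ?_
    simp [F, b.repr_apply_apply]
  rw [_root_.sub_apply, norm_sub_rev]
  refine le_of_tendsto ((hlim.sub_const (F t x)).norm) ?_
  filter_upwards [eventually_ge_atTop t] with u hu
  classical
  have h1 : F u x - F t x = ∑ i ∈ u \ t, inner ℂ (b i) x • T (b i) := by
    rw [sub_eq_iff_eq_add]
    simp only [F]
    simp only [_root_.sum_apply, ContinuousLinearMap.smulRight_apply,
      innerSL_apply_apply]
    exact (Finset.sum_sdiff hu).symm
  rw [h1]
  have h2 : ∑ i ∈ u \ t, ‖T (b i)‖ ^ 2 ≤ (δ / 2) ^ 2 := by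
    have := hs (u \ t) (Finset.sdiff_disjoint.mono_right ht)
    exact (le_abs_self _).trans this.le
  have h3 : ∑ i ∈ u \ t, ‖inner ℂ (b i) x‖ ^ 2 ≤ ‖x‖ ^ 2 :=
    b.orthonormal.sum_inner_products_le x
  calc ‖∑ i ∈ u \ t, inner ℂ (b i) x • T (b i)‖
      ≤ ∑ i ∈ u \ t, ‖inner ℂ (b i) x‖ * ‖T (b i)‖ :=
        (norm_sum_le _ _).trans (le_of_eq (by simp [norm_smul]))
    _ ≤ δ / 2 * ‖x‖ := by
        refine abs_le_of_sq_le_sq' ?_ (by positivity) |>.2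
        refine (Finset.sum_mul_sq_le_sq_mul_sq _ _ _).trans ?_
        rw [mul_pow, mul_comm]
        gcongr

/-- **Takagi's theorem** for compact operators: a compact operator `K` that is symmetric with
respect to a conjugation `J` has a vector `f ≠ 0` with `K f = ‖K‖ J f`. -/
theorem exists_apply_eq_norm_smul_conj {H : Type*} [NormedAddCommGroup H] [InnerProductSpace ℂ H]
    [CompleteSpace H] (J : H → H) (hJadd : ∀ x y, J (x + y) = J x + J y)
    (hJsmul : ∀ (c : ℂ) x, J (c • x) = (starRingEnd ℂ c) • J x) (hJJ : ∀ x, J (J x) = x)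
    (K : H →L[ℂ] H) (hK : IsCompactOperator K) (hK0 : K ≠ 0)
    (hsymm : ∀ x y, inner ℂ (J (K x)) y = inner ℂ (J x) (K y)) :
    ∃ f : H, f ≠ 0 ∧ K f = (‖K‖ : ℂ) • J f := by
  have hs : 0 < ‖K‖ := norm_pos_iff.2 hK0
  set T : H →L[ℂ] H := ContinuousLinearMap.adjoint K ∘L K with hT
  have hTn : ‖T‖ = ‖K‖ * ‖K‖ := ContinuousLinearMap.norm_adjoint_comp_self K
  have hTsa : IsSelfAdjoint T := IsSelfAdjoint.star_mul_self K
  have hTc : IsCompactOperator T := hK.clm_comp (ContinuousLinearMap.adjoint K)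
  have hnt : Nontrivial H := by
    by_contra hn
    rw [not_nontrivial_iff_subsingleton] at hn
    exact hK0 (ContinuousLinearMap.ext fun x => Subsingleton.elim _ _)
  -- For the self-adjoint operator `T = K*K` the spectral radius is `‖K‖²`; by compactness this
  -- nonzero spectral value is an eigenvalue.
  obtain ⟨k, hk, hkr⟩ := spectrum.exists_nnnorm_eq_spectralRadius T
  rw [T.spectralRadius_eq_nnnorm hTsa] at hkr
  have hkn : ‖k‖ = ‖K‖ * ‖K‖ := by
    rw [← hTn]
    exact congrArg NNReal.toReal (ENNReal.coe_injective hkr)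
  have hk0 : k ≠ 0 := by
    rw [← norm_pos_iff, hkn]
    positivity
  obtain ⟨v, hv⟩ := ((hTc.hasEigenvalue_iff_mem_spectrum hk0).2 hk).exists_hasEigenvector
  have hTv : T v = k • v := hv.apply_eq_smul
  have hv0 : v ≠ 0 := hv.2
  have hkreal : k = ((‖K‖ * ‖K‖ : ℝ) : ℂ) := by
    have h1 : inner ℂ v (T v) = k * (‖v‖ : ℂ) ^ 2 := by
      rw [hTv, inner_smul_right, inner_self_eq_norm_sq_to_K]
      rfl
    have h2 : inner ℂ v (T v) = (‖K v‖ : ℂ) ^ 2 := by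
      rw [hT, ContinuousLinearMap.comp_apply, ContinuousLinearMap.adjoint_inner_right,
        inner_self_eq_norm_sq_to_K]
      rfl
    have hvn : (‖v‖ : ℂ) ^ 2 ≠ 0 := by
      simpa using hv0
    have h3 : k = ((‖K v‖ ^ 2 / ‖v‖ ^ 2 : ℝ) : ℂ) := by
      push_cast
      rw [eq_div_iff hvn, ← h1, h2]
    rw [h3] at hkn ⊢
    rw [Complex.norm_real, Real.norm_of_nonneg (by positivity)] at hkn
    rw [hkn]
  -- The antilinear map `A = J ∘ K` is a square root of `K*K`; this is where the symmetry of `K`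
  -- enters.
  have hA2 : ∀ x, J (K (J (K x))) = T x := by
    intro x
    refine ext_inner_right ℂ fun y => ?_
    rw [hsymm, hJJ, hT, ContinuousLinearMap.comp_apply, ContinuousLinearMap.adjoint_inner_left]
  have hconj : (starRingEnd ℂ) (‖K‖ : ℂ) = (‖K‖ : ℂ) := Complex.conj_ofReal _
  have key : ∀ g, J (K g) = (‖K‖ : ℂ) • g → K g = (‖K‖ : ℂ) • J g := by
    intro g hg
    have := congrArg J hg
    rwa [hJJ, hJsmul, hconj] at this
  -- Since `A²v = ‖K‖²v`, the vector `Av + ‖K‖v` satisfies `Aw = ‖K‖w`. If it vanishes then `Av =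
  -- -‖K‖v`, and antilinearity flips the sign for `iv`.
  by_cases hg : J (K v) + (‖K‖ : ℂ) • v = 0
  · refine ⟨Complex.I • v, smul_ne_zero Complex.I_ne_zero hv0, key _ ?_⟩
    rw [map_smul, hJsmul, eq_neg_of_add_eq_zero_left hg, Complex.conj_I]
    module
  · refine ⟨_, hg, key _ ?_⟩
    rw [map_add, hJadd, hA2, hTv, hkreal, map_smul, hJsmul, hconj]
    push_cast
    module

/-! ### Multiplication operators on `L²`. -/

section Multiplication

variable {α : Type*} [MeasurableSpace α] {μ : Measure α}

/-- Multiplication by an essentially bounded function on `L²`. -/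
def mulLp (g : α → ℂ) (hg : MemLp g ∞ μ) : Lp ℂ 2 μ →L[ℂ] Lp ℂ 2 μ :=
  (ContinuousLinearMap.mul ℂ ℂ).holderL μ ∞ 2 2 (hg.toLp g)

theorem coeFn_mulLp (g : α → ℂ) (hg : MemLp g ∞ μ) (f : Lp ℂ 2 μ) :
    mulLp g hg f =ᵐ[μ] fun x => g x * f x := by
  have h := (ContinuousLinearMap.mul ℂ ℂ).coeFn_holder (r := 2) (hg.toLp g) f
  filter_upwards [h, hg.coeFn_toLp] with x h1 h2
  rw [← h2]
  exact h1

theorem norm_mulLp_le {g : α → ℂ} (hg : MemLp g ∞ μ) {C : ℝ} (hC0 : 0 ≤ C)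
    (hC : ∀ x, ‖g x‖ ≤ C) : ‖mulLp g hg‖ ≤ C := by
  refine ContinuousLinearMap.opNorm_le_bound _ hC0 fun f => ?_
  refine Lp.norm_le_mul_norm_of_ae_le_mul ?_
  filter_upwards [coeFn_mulLp g hg f] with x hx
  rw [hx, norm_mul]
  gcongr
  exact hC x

/-- Conjugating the first slot makes the inner product the bilinear form `∫ f h`, for which
multiplication is symmetric without any conjugate on `g`. -/
theorem inner_star_mulLp (g : α → ℂ) (hg : MemLp g ∞ μ) (f h : Lp ℂ 2 μ) :
    inner ℂ (star (mulLp g hg f)) h = inner ℂ (star f) (mulLp g hg h) := by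
  rw [L2.inner_def, L2.inner_def]
  refine integral_congr_ae ?_
  filter_upwards [coeFn_mulLp g hg f, coeFn_mulLp g hg h, Lp.coeFn_star f,
    Lp.coeFn_star (mulLp g hg f)] with x h1 h2 h3 h4
  simp only [h4, h3, h2, h1, Pi.star_apply, RCLike.inner_apply, star_mul', RCLike.star_def,
    map_mul, starRingEnd_self_apply]
  ring

theorem memLp_top_indicator_one {s : Set α} (hs : MeasurableSet s) :
    MemLp (s.indicator (fun _ => (1 : ℂ))) ∞ μ :=
  (memLp_top_const (1 : ℂ)).indicator hs

/-- Restriction to a measurable set, as an operator on `L²`. -/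
def cutoff (μ : Measure α) {s : Set α} (hs : MeasurableSet s) : Lp ℂ 2 μ →L[ℂ] Lp ℂ 2 μ :=
  mulLp (s.indicator fun _ => (1 : ℂ)) (memLp_top_indicator_one hs)

theorem coeFn_cutoff {s : Set α} (hs : MeasurableSet s) (f : Lp ℂ 2 μ) :
    cutoff μ hs f =ᵐ[μ] s.indicator f := by
  filter_upwards [coeFn_mulLp _ (memLp_top_indicator_one (μ := μ) hs) f] with x hx
  rw [cutoff, hx]
  by_cases h : x ∈ s <;> simp [h]

end Multiplication

/-! ### The symbol of `-Δ - z` and its inverse: growth and decay. -/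

section HelmholtzSymbol

variable {E : Type*} [NormedAddCommGroup E]

/-- The symbol of `-Δ - z`. -/
def helmholtzSymbol (E : Type*) [NormedAddCommGroup E] (z : ℂ) (ξ : E) : ℂ :=
  (((2 * Real.pi) ^ 2 * ‖ξ‖ ^ 2 : ℝ) : ℂ) - z

theorem hasTemperateGrowth_helmholtzSymbol [InnerProductSpace ℝ E] (z : ℂ) :
    (helmholtzSymbol E z).HasTemperateGrowth := by
  unfold helmholtzSymbol
  fun_prop

theorem abs_im_le_norm_helmholtzSymbol (z : ℂ) (ξ : E) : |z.im| ≤ ‖helmholtzSymbol E z ξ‖ := by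
  refine le_trans (le_of_eq ?_) (Complex.abs_im_le_norm _)
  rw [helmholtzSymbol, Complex.sub_im, Complex.ofReal_im, zero_sub, abs_neg]

theorem helmholtzSymbol_ne_zero {z : ℂ} (hz : z.im ≠ 0) (ξ : E) : helmholtzSymbol E z ξ ≠ 0 := by
  rw [← norm_pos_iff]
  exact (abs_pos.2 hz).trans_le (abs_im_le_norm_helmholtzSymbol z ξ)

theorem iteratedDeriv_inv_linear_sub {z : ℂ} (hz : z.im ≠ 0) (a : ℝ) (n : ℕ) :
    iteratedDeriv n (fun t : ℝ => ((a * t : ℝ) - z : ℂ)⁻¹) =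
      fun t : ℝ => ((-a) ^ n * n.factorial : ℂ) * (((a * t : ℝ) - z : ℂ) ^ (n + 1))⁻¹ := by
  have h0 : ∀ t : ℝ, ((a * t : ℝ) - z : ℂ) ≠ 0 := fun t h => hz (by
    have := congrArg Complex.im h
    simpa using this)
  induction n with
  | zero => simp
  | succ n ih =>
    rw [iteratedDeriv_succ, ih]
    ext t
    have h1 : HasDerivAt (fun t : ℝ => ((a * t : ℝ) - z : ℂ)) a t := by
      have := (((hasDerivAt_id t).const_mul a).ofReal_comp).sub_const z
      simpa using this
    have h2 := ((h1.pow (n + 1)).inv (pow_ne_zero _ (h0 t))).const_mul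
      ((-a) ^ n * n.factorial : ℂ)
    refine h2.deriv.trans ?_
    rw [Nat.factorial_succ]
    push_cast
    have := h0 t
    push_cast at this
    simp only [Pi.pow_apply]
    field_simp
    ring_nf

/-- The denominator stays at distance at least `|Im z|` from 0, so every derivative is bounded.
Composition with `‖ξ‖²` then reduces the inverse symbol to this one-variable function. -/
theorem hasTemperateGrowth_inv_linear_sub {z : ℂ} (hz : z.im ≠ 0) (a : ℝ) :
    (fun t : ℝ => ((a * t : ℝ) - z : ℂ)⁻¹).HasTemperateGrowth := by
  have h0 : ∀ t : ℝ, ((a * t : ℝ) - z : ℂ) ≠ 0 := fun t h => hz (by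
    have := congrArg Complex.im h
    simpa using this)
  refine ⟨?_, fun n => ⟨0, ‖((-a) ^ n * n.factorial : ℂ)‖ * (|z.im| ^ (n + 1))⁻¹, fun t => ?_⟩⟩
  · refine ContDiff.inv ?_ h0
    exact (Complex.ofRealCLM.contDiff.comp (contDiff_const.mul contDiff_id)).sub contDiff_const
  · rw [norm_iteratedFDeriv_eq_norm_iteratedDeriv, iteratedDeriv_inv_linear_sub hz, norm_mul,
      norm_inv, norm_pow, pow_zero, mul_one]
    have h1 : |z.im| ≤ ‖((a * t : ℝ) - z : ℂ)‖ := by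
      refine le_trans (le_of_eq ?_) (Complex.abs_im_le_norm _)
      rw [Complex.sub_im, Complex.ofReal_im, zero_sub, abs_neg]
    have h2 := abs_pos.2 hz
    gcongr

theorem hasTemperateGrowth_inv_helmholtzSymbol [InnerProductSpace ℝ E] {z : ℂ} (hz : z.im ≠ 0) :
    (fun ξ : E => (helmholtzSymbol E z ξ)⁻¹).HasTemperateGrowth :=
  (hasTemperateGrowth_inv_linear_sub hz _).comp (Function.hasTemperateGrowth_norm_sq E)

theorem norm_inv_helmholtzSymbol_le {z : ℂ} (hz : z.im ≠ 0) (ξ : E) :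
    ‖(helmholtzSymbol E z ξ)⁻¹‖ ≤ |z.im|⁻¹ := by
  rw [norm_inv]
  exact inv_anti₀ (abs_pos.2 hz) (abs_im_le_norm_helmholtzSymbol z ξ)

theorem exists_norm_inv_helmholtzSymbol_le (z : ℂ) {δ : ℝ} (hδ : 0 < δ) :
    ∃ r : ℝ, ∀ ξ : E, r < ‖ξ‖ → ‖(helmholtzSymbol E z ξ)⁻¹‖ ≤ δ := by
  -- The summand 1 ensures `‖ξ‖ ≤ ‖ξ‖²`; the rest makes the symbol at least `δ⁻¹` after subtracting
  -- `z`.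
  refine ⟨δ⁻¹ + ‖z‖ + 1, fun ξ hξ => ?_⟩
  have hδ' := inv_pos.2 hδ
  have h1 : δ⁻¹ ≤ ‖helmholtzSymbol E z ξ‖ := by
    have h2 := norm_sub_norm_le (((2 * Real.pi) ^ 2 * ‖ξ‖ ^ 2 : ℝ) : ℂ) z
    rw [Complex.norm_real, Real.norm_of_nonneg (by positivity)] at h2
    have h3 : (1 : ℝ) ≤ (2 * Real.pi) ^ 2 := by nlinarith [Real.pi_gt_three]
    have h4 := norm_nonneg z
    have h5 : ‖ξ‖ ≤ (2 * Real.pi) ^ 2 * ‖ξ‖ ^ 2 := by nlinarith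
    exact le_trans (by linarith) h2
  rw [norm_inv]
  exact inv_le_of_inv_le₀ hδ h1

end HelmholtzSymbol

/-! ### The free resolvent: inversion, symmetry and `H²` regularity. -/

section Resolvent

variable {E : Type*} [NormedAddCommGroup E] [InnerProductSpace ℝ E] [FiniteDimensional ℝ E]
  [MeasurableSpace E] [BorelSpace E]

theorem toTemperedDistribution_injective {f g : Lp ℂ 2 (volume : Measure E)}
    (h : (f : 𝓢'(E, ℂ)) = g) : f = g :=
  LinearMap.ker_eq_bot.mp (Lp.ker_toTemperedDistributionCLM_eq_bot (E := E) (F := ℂ)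
    (p := 2) (μ := volume)) h

theorem inner_star_toLp (f : Lp ℂ 2 (volume : Measure E)) (φ : 𝓢(E, ℂ)) :
    inner ℂ (star f) (φ.toLp 2) = (f : 𝓢'(E, ℂ)) φ := by
  rw [L2.inner_def, Lp.toTemperedDistribution_apply]
  refine integral_congr_ae ?_
  filter_upwards [φ.coeFn_toLp 2, Lp.coeFn_star f] with x h1 h2
  rw [h1, h2, Pi.star_apply, RCLike.inner_apply, RCLike.star_def, starRingEnd_self_apply,
    smul_eq_mul]

/-- The Fourier multiplier on `L²` with an essentially bounded symbol. -/
def fourierMulLp (g : E → ℂ) (hg : MemLp g ∞ volume) :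
    Lp ℂ 2 (volume : Measure E) →L[ℂ] Lp ℂ 2 (volume : Measure E) :=
  ((Lp.fourierTransformₗᵢ E ℂ).symm : Lp ℂ 2 (volume : Measure E) →L[ℂ] _) ∘L mulLp g hg ∘L
    ((Lp.fourierTransformₗᵢ E ℂ) : Lp ℂ 2 (volume : Measure E) →L[ℂ] _)

-- Bridge from the `L²` operator to the distributional multiplier, where symbols can be multiplied
-- and `-Δ` acts without a domain.
open FourierTransform in
theorem toTemperedDistribution_fourierMulLp {g : E → ℂ} (hg : MemLp g ∞ volume)
    (hgt : g.HasTemperateGrowth) (f : Lp ℂ 2 (volume : Measure E)) :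
    (fourierMulLp g hg f : 𝓢'(E, ℂ)) = fourierMultiplierCLM ℂ g f := by
  have h1 : fourierMulLp g hg f = 𝓕⁻ (mulLp g hg (𝓕 f)) := rfl
  have h2 : mulLp g hg (𝓕 f) = (hg.toLp g) • 𝓕 f := by
    refine Lp.ext ?_
    filter_upwards [coeFn_mulLp g hg (𝓕 f), Lp.coeFn_lpSMul (r := 2) (hg.toLp g) (𝓕 f),
      hg.coeFn_toLp] with x h3 h4 h5
    rw [h3, h4, Pi.smul_apply', h5, smul_eq_mul]
  rw [h1, ← Lp.fourierInv_toTemperedDistribution_eq, h2, Lp.toTemperedDistribution_smul_eq hgt,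
    ← Lp.fourier_toTemperedDistribution_eq, fourierMultiplierCLM_apply]

theorem memLp_top_inv_helmholtzSymbol {z : ℂ} (hz : z.im ≠ 0) :
    MemLp (fun ξ : E => (helmholtzSymbol E z ξ)⁻¹) ∞ volume :=
  memLp_top_of_bound
    (hasTemperateGrowth_inv_helmholtzSymbol hz).1.continuous.aestronglyMeasurable _
    (Eventually.of_forall (norm_inv_helmholtzSymbol_le hz))

theorem neg_laplacian_sub_smul_eq (z : ℂ) (u : 𝓢'(E, ℂ)) :
    -Δ u - z • u = fourierMultiplierCLM ℂ (helmholtzSymbol E z) u := by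
  have h1 : fourierMultiplierCLM ℂ (helmholtzSymbol E z) u =
      fourierMultiplierCLM ℂ (((2 * Real.pi) ^ 2 : ℂ) • fun ξ : E => ((‖ξ‖ ^ 2 : ℝ) : ℂ)) u -
        fourierMultiplierCLM ℂ (fun _ : E => z) u := by
    simp only [fourierMultiplierCLM_apply]
    rw [← FourierTransform.fourierInvCLM_apply (R := ℂ), ← FourierTransform.fourierInvCLM_apply (R := ℂ),
      ← FourierTransform.fourierInvCLM_apply (R := ℂ), ← map_sub, ← _root_.sub_apply,
      ← smulLeftCLM_sub (by fun_prop) (by fun_prop)]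
    congr 2
    congr 1
    ext ξ
    simp [helmholtzSymbol]
  rw [h1, fourierMultiplierCLM_smul (by fun_prop), fourierMultiplierCLM_const,
    laplacian_eq_fourierMultiplierCLM]
  rw [neg_smul, neg_neg]
  simp only [_root_.smul_apply, ContinuousLinearMap.id_apply, sub_left_inj]
  rw [← Complex.coe_smul]
  norm_num

theorem inv_helmholtz_helmholtz {z : ℂ} (hz : z.im ≠ 0) (u : 𝓢'(E, ℂ)) :
    fourierMultiplierCLM ℂ (fun ξ => (helmholtzSymbol E z ξ)⁻¹)
      (fourierMultiplierCLM ℂ (helmholtzSymbol E z) u) = u := by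
  rw [fourierMultiplierCLM_fourierMultiplierCLM_apply (hasTemperateGrowth_helmholtzSymbol z)
    (hasTemperateGrowth_inv_helmholtzSymbol hz)]
  have : (helmholtzSymbol E z * fun ξ => (helmholtzSymbol E z ξ)⁻¹) = fun _ => 1 := by
    ext ξ
    exact mul_inv_cancel₀ (helmholtzSymbol_ne_zero hz ξ)
  rw [this]
  simp

theorem helmholtz_inv_helmholtz {z : ℂ} (hz : z.im ≠ 0) (u : 𝓢'(E, ℂ)) :
    fourierMultiplierCLM ℂ (helmholtzSymbol E z)
      (fourierMultiplierCLM ℂ (fun ξ => (helmholtzSymbol E z ξ)⁻¹) u) = u := by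
  rw [fourierMultiplierCLM_fourierMultiplierCLM_apply (hasTemperateGrowth_inv_helmholtzSymbol hz)
    (hasTemperateGrowth_helmholtzSymbol z)]
  have : ((fun ξ => (helmholtzSymbol E z ξ)⁻¹) * helmholtzSymbol E z) = fun _ => 1 := by
    ext ξ
    exact inv_mul_cancel₀ (helmholtzSymbol_ne_zero hz ξ)
  rw [this]
  simp

/-- The free resolvent `(-Δ - z)⁻¹` on `L²` for non-real `z`. -/
def freeResolvent (E : Type*) [NormedAddCommGroup E] [InnerProductSpace ℝ E]
    [FiniteDimensional ℝ E] [MeasurableSpace E] [BorelSpace E] {z : ℂ} (hz : z.im ≠ 0) :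
    Lp ℂ 2 (volume : Measure E) →L[ℂ] Lp ℂ 2 (volume : Measure E) :=
  fourierMulLp (fun ξ => (helmholtzSymbol E z ξ)⁻¹) (memLp_top_inv_helmholtzSymbol hz)

theorem toTemperedDistribution_freeResolvent {z : ℂ} (hz : z.im ≠ 0)
    (f : Lp ℂ 2 (volume : Measure E)) :
    (freeResolvent E hz f : 𝓢'(E, ℂ)) =
      fourierMultiplierCLM ℂ (fun ξ => (helmholtzSymbol E z ξ)⁻¹) f :=
  toTemperedDistribution_fourierMulLp _ (hasTemperateGrowth_inv_helmholtzSymbol hz) f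

theorem neg_laplacian_freeResolvent {z : ℂ} (hz : z.im ≠ 0) (f : Lp ℂ 2 (volume : Measure E)) :
    -Δ (freeResolvent E hz f : 𝓢'(E, ℂ)) - z • (freeResolvent E hz f : 𝓢'(E, ℂ)) = f := by
  rw [neg_laplacian_sub_smul_eq, toTemperedDistribution_freeResolvent, helmholtz_inv_helmholtz hz]

theorem toTemperedDistribution_helmholtz_toLp (z : ℂ) (φ : 𝓢(E, ℂ)) :
    (((-Δ φ - z • φ).toLp 2 : Lp ℂ 2 (volume : Measure E)) : 𝓢'(E, ℂ)) =
      fourierMultiplierCLM ℂ (helmholtzSymbol E z)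
        ((φ.toLp 2 : Lp ℂ 2 (volume : Measure E)) : 𝓢'(E, ℂ)) := by
  rw [← neg_laplacian_sub_smul_eq, Lp.toTemperedDistribution_toLp_eq,
    Lp.toTemperedDistribution_toLp_eq, map_sub, map_neg, map_smul,
    laplacian_toTemperedDistributionCLM_eq]

theorem freeResolvent_helmholtz {z : ℂ} (hz : z.im ≠ 0) (φ : 𝓢(E, ℂ)) :
    freeResolvent E hz ((-Δ φ - z • φ).toLp 2) = φ.toLp 2 := by
  apply toTemperedDistribution_injective
  rw [toTemperedDistribution_freeResolvent, toTemperedDistribution_helmholtz_toLp,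
    inv_helmholtz_helmholtz hz]

/-- By density `g` may be taken Schwartz, hence of the form `(-Δ - z)φ` with `φ` Schwartz. Both
sides are then pairings with test functions, and `-Δ - z` moves across by the definition of the
distributional Laplacian. -/
theorem inner_star_freeResolvent {z : ℂ} (hz : z.im ≠ 0) (f g : Lp ℂ 2 (volume : Measure E)) :
    inner ℂ (star (freeResolvent E hz f)) g = inner ℂ (star f) (freeResolvent E hz g) := by
  refine DenseRange.induction_on (p := fun g => inner ℂ (star (freeResolvent E hz f)) g =
    inner ℂ (star f) (freeResolvent E hz g))
    (SchwartzMap.denseRange_toLpCLM (p := 2) (μ := volume) ENNReal.ofNat_ne_top) g ?_ ?_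
  · exact isClosed_eq (by fun_prop) (by fun_prop)
  intro h
  rw [SchwartzMap.toLpCLM_apply]
  set φ := SchwartzMap.fourierMultiplierCLM ℂ (fun ξ => (helmholtzSymbol E z ξ)⁻¹) h with hφ
  have h1 : (h.toLp 2 : Lp ℂ 2 (volume : Measure E)) = (-Δ φ - z • φ).toLp 2 := by
    apply toTemperedDistribution_injective
    rw [toTemperedDistribution_helmholtz_toLp, Lp.toTemperedDistribution_toLp_eq,
      Lp.toTemperedDistribution_toLp_eq, hφ,
      ← fourierMultiplierCLM_toTemperedDistributionCLM_eq
        (hasTemperateGrowth_inv_helmholtzSymbol hz), helmholtz_inv_helmholtz hz]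
  rw [h1, freeResolvent_helmholtz, inner_star_toLp, inner_star_toLp,
    ← neg_laplacian_freeResolvent hz f, map_sub, map_neg, map_smul]
  simp

theorem memSobolev_freeResolvent {z : ℂ} (hz : z.im ≠ 0) (f : Lp ℂ 2 (volume : Measure E)) :
    MemSobolev 2 2 (freeResolvent E hz f : 𝓢'(E, ℂ)) := by
  have h0 : MemSobolev 0 2 (f : 𝓢'(E, ℂ)) := memSobolev_zero_iff.2 ⟨f, rfl⟩
  -- It suffices that the Bessel potential of order 2 maps the resolvent into `L²`, that is, that
  -- the combined symbol `(1 + ‖ξ‖²) / ((2π)²‖ξ‖² - z)` is bounded.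
  rw [← add_zero (2 : ℝ), ← memSobolev_besselPotential_iff, toTemperedDistribution_freeResolvent,
    besselPotential, fourierMultiplierCLM_fourierMultiplierCLM_apply
      (hasTemperateGrowth_inv_helmholtzSymbol hz) (by fun_prop)]
  refine h0.fourierMultiplierCLM_of_bounded
    ((hasTemperateGrowth_inv_helmholtzSymbol hz).mul (by fun_prop)) ?_
  refine ⟨1 + (1 + ‖z‖) * |z.im|⁻¹, fun ξ => ?_⟩
  have hs := helmholtzSymbol_ne_zero hz ξ
  have hp := norm_pos_iff.2 hs
  have h1 : ‖((1 + ‖ξ‖ ^ 2 : ℝ) : ℂ)‖ ≤ ‖helmholtzSymbol E z ξ‖ + (1 + ‖z‖) := by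
    rw [Complex.norm_real, Real.norm_of_nonneg (by positivity)]
    have h2 : ‖((((2 * Real.pi) ^ 2 * ‖ξ‖ ^ 2 : ℝ)) : ℂ)‖ ≤ ‖helmholtzSymbol E z ξ‖ + ‖z‖ := by
      refine le_trans (le_of_eq ?_) (norm_add_le _ _)
      rw [helmholtzSymbol, sub_add_cancel]
    rw [Complex.norm_real, Real.norm_of_nonneg (by positivity)] at h2
    have h3 : (1 : ℝ) ≤ (2 * Real.pi) ^ 2 := by nlinarith [Real.pi_gt_three]
    nlinarith [sq_nonneg ‖ξ‖]
  rw [Pi.mul_apply, norm_mul, div_self two_ne_zero, Real.rpow_one]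
  calc ‖(helmholtzSymbol E z ξ)⁻¹‖ * ‖((1 + ‖ξ‖ ^ 2 : ℝ) : ℂ)‖
      ≤ ‖(helmholtzSymbol E z ξ)⁻¹‖ * (‖helmholtzSymbol E z ξ‖ + (1 + ‖z‖)) := by gcongr
    _ = 1 + (1 + ‖z‖) * ‖(helmholtzSymbol E z ξ)⁻¹‖ := by
      rw [norm_inv]
      field_simp
    _ ≤ _ := by
      gcongr
      exact norm_inv_helmholtzSymbol_le hz ξ

end Resolvent

/-! ### Compactness of operators with a bounded kernel. -/

section IntegralOperator

theorem norm_sq_eq_integral_norm_sq {α : Type*} [MeasurableSpace α] {μ : Measure α}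
    (f : Lp ℂ 2 μ) : ‖f‖ ^ 2 = ∫ x, ‖f x‖ ^ 2 ∂μ := by
  have h : inner ℂ f f = ((∫ x, ‖f x‖ ^ 2 ∂μ : ℝ) : ℂ) := by
    rw [L2.inner_def, ← integral_complex_ofReal]
    refine integral_congr_ae (Eventually.of_forall fun x => ?_)
    simp only [inner_self_eq_norm_sq_to_K]
    norm_cast
  rw [inner_self_eq_norm_sq_to_K] at h
  apply Complex.ofReal_injective
  rw [← h]
  norm_cast

/-- An operator into `L²` given by a bounded kernel on a set of finite measure is compact. -/
theorem isCompactOperator_of_bounded_kernel {α : Type*} [MeasurableSpace α] {μ : Measure α}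
    {H : Type*} [NormedAddCommGroup H] [InnerProductSpace ℂ H] [CompleteSpace H]
    (T : H →L[ℂ] Lp ℂ 2 μ) {s : Set α} (hs : MeasurableSet s) (hμs : μ s ≠ ∞) (k : α → H) (C : ℝ)
    (hk : ∀ x, ‖k x‖ ≤ C)
    (hT : ∀ f : H, T f =ᵐ[μ] s.indicator fun x => inner ℂ (k x) f) : IsCompactOperator T := by
  obtain ⟨w, b, -⟩ := exists_hilbertBasis ℂ H
  refine isCompactOperator_of_summable_norm_sq b T ?_
  -- The Hilbert–Schmidt sum is bounded pointwise in `x`: Bessel's inequality for the kernel vector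
  -- `k x` gives at most `C²` on `s`.
  refine summable_of_sum_le (c := ∫ x, s.indicator (fun _ => C ^ 2) x ∂μ)
    (fun _ => by positivity) fun t => ?_
  simp_rw [norm_sq_eq_integral_norm_sq]
  rw [← integral_finsetSum _ fun i _ =>
    (memLp_two_iff_integrable_sq_norm (Lp.aestronglyMeasurable _)).1 (Lp.memLp (T (b i)))]
  refine integral_mono_of_nonneg (Eventually.of_forall fun x => by positivity)
    ((integrable_indicator_iff hs).2 (integrableOn_const hμs)) ?_
  have hall : ∀ᵐ x ∂μ, ∀ i ∈ t, T (b i) x = s.indicator (fun x => inner ℂ (k x) (b i)) x :=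
    (Finset.eventually_all t).2 fun i _ => hT (b i)
  filter_upwards [hall] with x hx
  rw [Finset.sum_congr rfl fun i hi => by rw [hx i hi]]
  by_cases hxs : x ∈ s
  · simp only [Set.indicator_of_mem hxs]
    calc ∑ i ∈ t, ‖inner ℂ (k x) (b i)‖ ^ 2 = ∑ i ∈ t, ‖inner ℂ (b i) (k x)‖ ^ 2 := by
          simp_rw [norm_inner_symm (k x)]
      _ ≤ ‖k x‖ ^ 2 := b.orthonormal.sum_inner_products_le _
      _ ≤ C ^ 2 := by
          gcongr
          exact hk x
  · simp [Set.indicator_of_notMem hxs]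

end IntegralOperator

/-! ### Compactness of the resolvent between sets of finite measure. -/

section FourierCutoff

open FourierTransform

variable {E : Type*} [NormedAddCommGroup E] [InnerProductSpace ℝ E] [FiniteDimensional ℝ E]
  [MeasurableSpace E] [BorelSpace E]

/-- The `L²` Fourier transform agrees with the Fourier integral on `L¹ ∩ L²`. -/
theorem fourier_ae_eq_of_integrable (f : Lp ℂ 2 (volume : Measure E)) (hf : Integrable f) :
    (𝓕 f : Lp ℂ 2 (volume : Measure E)) =ᵐ[volume] 𝓕 (f : E → ℂ) := by
  have hcont : Continuous (𝓕 (f : E → ℂ)) :=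
    VectorFourier.fourierIntegral_continuous Real.continuous_fourierChar continuous_inner hf
  refine ae_eq_of_integral_contDiff_smul_eq
    ((Lp.memLp (𝓕 f)).locallyIntegrable one_le_two) hcont.locallyIntegrable fun g hg hgc => ?_
  have hg₁ : HasCompactSupport (Complex.ofRealCLM ∘ g) := hgc.comp_left rfl
  have hg₂ := Complex.ofRealCLM.contDiff.comp hg
  set φ : 𝓢(E, ℂ) := hg₁.toSchwartzMap hg₂ with hφ
  have hφa : ∀ x, φ x = g x := fun x => rfl
  have h1 : ∫ x, g x • (𝓕 f : Lp ℂ 2 (volume : Measure E)) x = (𝓕 (f : 𝓢'(E, ℂ))) φ := by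
    rw [Lp.fourier_toTemperedDistribution_eq, Lp.toTemperedDistribution_apply]
    simp [hφa]
  have h2 := VectorFourier.integral_fourierIntegral_smul_eq_flip (μ := volume) (ν := volume)
    (L := innerₗ E) (f := φ) (g := f) Real.continuous_fourierChar continuous_inner φ.integrable hf
  rw [flip_innerₗ] at h2
  rw [h1, TemperedDistribution.fourier_apply, Lp.toTemperedDistribution_apply]
  refine Eq.trans ?_ (h2.trans ?_)
  · refine integral_congr_ae (Eventually.of_forall fun x => ?_)
    simp only [SchwartzMap.fourier_coe]
    rfl
  · refine integral_congr_ae (Eventually.of_forall fun x => ?_)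
    simp only [hφa]
    exact Complex.coe_smul _ _

theorem memLp_top_fourierChar_inner (ξ : E) :
    MemLp (fun x : E => (Real.fourierChar (inner ℝ x ξ) : ℂ)) ∞ volume := by
  refine memLp_top_of_bound (Continuous.aestronglyMeasurable ?_) 1
    (Eventually.of_forall fun x => (Circle.norm_coe _).le)
  exact continuous_subtype_val.comp (Real.continuous_fourierChar.comp (by fun_prop))

/-- The character `x ↦ e^(2πi⟨x, ξ⟩)` restricted to a set of finite measure. -/
def restrictedChar {s : Set E} (hs : MeasurableSet s) (hμs : volume s ≠ ∞) (ξ : E) :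
    Lp ℂ 2 (volume : Measure E) :=
  mulLp _ (memLp_top_fourierChar_inner ξ) (indicatorConstLp 2 hs hμs 1)

theorem norm_restrictedChar_le {s : Set E} (hs : MeasurableSet s) (hμs : volume s ≠ ∞) (ξ : E) :
    ‖restrictedChar hs hμs ξ‖ ≤ ‖indicatorConstLp 2 hs hμs (1 : ℂ)‖ := by
  refine (ContinuousLinearMap.le_opNorm _ _).trans ?_
  refine mul_le_of_le_one_left (norm_nonneg _) (norm_mulLp_le _ zero_le_one fun x => ?_)
  exact (Circle.norm_coe _).le

/-- On a set of finite measure `L²` embeds in `L¹`, so the Fourier integral converges. This exhibits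
the transform as an operator with a bounded kernel. -/
theorem fourier_cutoff_ae_eq {s : Set E} (hs : MeasurableSet s) (hμs : volume s ≠ ∞)
    (f : Lp ℂ 2 (volume : Measure E)) :
    (𝓕 (cutoff volume hs f) : Lp ℂ 2 (volume : Measure E)) =ᵐ[volume]
      fun ξ => inner ℂ (restrictedChar hs hμs ξ) f := by
  have hint : Integrable (cutoff volume hs f) := by
    refine ((integrable_congr (coeFn_cutoff hs f)).2 ?_)
    exact (integrable_indicator_iff hs).2
      (integrableOn_Lp_of_measure_ne_top f one_le_two hμs)
  refine (fourier_ae_eq_of_integrable _ hint).trans (Eventually.of_forall fun ξ => ?_)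
  dsimp only
  rw [Real.fourier_eq, L2.inner_def]
  refine integral_congr_ae ?_
  filter_upwards [coeFn_cutoff hs f, coeFn_mulLp _ (memLp_top_fourierChar_inner ξ)
      (indicatorConstLp 2 hs hμs 1),
    indicatorConstLp_coeFn (p := 2) (hs := hs) (hμs := hμs) (c := (1 : ℂ))] with x h1 h2 h3
  rw [h1, restrictedChar, h2, h3, Circle.smul_def, AddChar.map_neg_eq_inv, Circle.coe_inv_eq_conj]
  by_cases hx : x ∈ s
  · simp [hx, mul_comm]
  · simp [hx]

theorem isCompactOperator_cutoff_fourier_cutoff {s t : Set E} (hs : MeasurableSet s)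
    (hμs : volume s ≠ ∞) (ht : MeasurableSet t) (hμt : volume t ≠ ∞) :
    IsCompactOperator (cutoff volume ht ∘L
      ((Lp.fourierTransformₗᵢ E ℂ) : Lp ℂ 2 (volume : Measure E) →L[ℂ] _) ∘L
        cutoff volume hs) := by
  refine isCompactOperator_of_bounded_kernel _ ht hμt (restrictedChar hs hμs) _
    (norm_restrictedChar_le hs hμs) fun f => ?_
  refine (coeFn_cutoff ht _).trans ?_
  filter_upwards [fourier_cutoff_ae_eq hs hμs f] with ξ hξ
  by_cases h : ξ ∈ t
  · simp only [Set.indicator_of_mem h]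
    exact hξ
  · simp only [Set.indicator_of_notMem h]

/-- The truncation error is multiplication by `m` outside the ball, whose norm is at most the
supremum of `|m|` there. -/
theorem tendsto_mulLp_comp_cutoff_closedBall {m : E → ℂ} (hm : MemLp m ∞ volume)
    (hm0 : ∀ δ > 0, ∃ r : ℝ, ∀ ξ : E, r < ‖ξ‖ → ‖m ξ‖ ≤ δ) :
    Tendsto (fun n : ℕ => mulLp m hm ∘L cutoff volume
      (Metric.isClosed_closedBall.measurableSet : MeasurableSet (Metric.closedBall (0 : E) n)))
      atTop (𝓝 (mulLp m hm)) := by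
  rw [Metric.tendsto_atTop]
  intro δ hδ
  obtain ⟨r, hr⟩ := hm0 _ (half_pos hδ)
  obtain ⟨N, hN⟩ := exists_nat_ge r
  refine ⟨N, fun n hn => ?_⟩
  rw [dist_eq_norm]
  refine lt_of_le_of_lt (ContinuousLinearMap.opNorm_le_bound _ (half_pos hδ).le fun f => ?_)
    (half_lt_self hδ)
  refine Lp.norm_le_mul_norm_of_ae_le_mul ?_
  rw [_root_.sub_apply, ContinuousLinearMap.comp_apply]
  have hB : MeasurableSet (Metric.closedBall (0 : E) n) := Metric.isClosed_closedBall.measurableSet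
  filter_upwards [coeFn_mulLp m hm f, coeFn_mulLp m hm (cutoff volume hB f),
    coeFn_cutoff hB f, Lp.coeFn_sub (mulLp m hm (cutoff volume hB f)) (mulLp m hm f)]
    with ξ h1 h2 h3 h4
  rw [h4, Pi.sub_apply, h1, h2, h3]
  by_cases hξ : ξ ∈ Metric.closedBall (0 : E) n
  · rw [Set.indicator_of_mem hξ, sub_self, norm_zero]
    positivity
  · rw [Set.indicator_of_notMem hξ, mul_zero, zero_sub, norm_neg, norm_mul]
    gcongr
    refine hr ξ ?_
    rw [mem_closedBall_zero_iff, not_le] at hξ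
    exact (hN.trans (Nat.cast_le.2 hn)).trans_lt hξ

/-- The free resolvent is compact between sets of finite measure. -/
theorem isCompactOperator_cutoff_freeResolvent_cutoff {z : ℂ} (hz : z.im ≠ 0) {s : Set E}
    (hs : MeasurableSet s) (hμs : volume s ≠ ∞) :
    IsCompactOperator (cutoff volume hs ∘L freeResolvent E hz ∘L cutoff volume hs) := by
  -- Restricting frequencies to a ball gives a compact operator, and the decay of the inverse symbol
  -- makes these restrictions converge in norm.
  have hcomp : IsCompactOperator (mulLp _ (memLp_top_inv_helmholtzSymbol (E := E) hz) ∘L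
      (((Lp.fourierTransformₗᵢ E ℂ) : Lp ℂ 2 (volume : Measure E) →L[ℂ]
        Lp ℂ 2 (volume : Measure E)) ∘L cutoff volume hs)) := by
    have hlim := tendsto_mulLp_comp_cutoff_closedBall (memLp_top_inv_helmholtzSymbol (E := E) hz)
      fun δ hδ => exists_norm_inv_helmholtzSymbol_le z hδ
    generalize mulLp _ (memLp_top_inv_helmholtzSymbol (E := E) hz) = S at hlim ⊢
    refine isCompactOperator_of_tendsto (l := atTop)
      (((ContinuousLinearMap.compL ℂ _ _ _).flip (((Lp.fourierTransformₗᵢ E ℂ) :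
        Lp ℂ 2 (volume : Measure E) →L[ℂ] Lp ℂ 2 (volume : Measure E)) ∘L
          cutoff volume hs)).continuous.tendsto S |>.comp hlim)
      (Eventually.of_forall fun n => ?_)
    exact (isCompactOperator_cutoff_fourier_cutoff hs hμs
      Metric.isClosed_closedBall.measurableSet measure_closedBall_lt_top.ne).clm_comp S
  have h := hcomp.clm_comp (cutoff volume hs ∘L
    ((Lp.fourierTransformₗᵢ E ℂ).symm : Lp ℂ 2 (volume : Measure E) →L[ℂ]
      Lp ℂ 2 (volume : Measure E)))
  exact h

end FourierCutoff

/-! ### Wave packets adapted to the tube. -/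

section WavePacket

open LineDeriv

theorem iteratedDeriv_exp_mul_I (n : ℕ) :
    iteratedDeriv n (fun t : ℝ => Complex.exp (t * Complex.I)) =
      fun t : ℝ => Complex.I ^ n * Complex.exp (t * Complex.I) := by
  induction n with
  | zero => simp
  | succ n ih =>
    rw [iteratedDeriv_succ, ih]
    ext t
    have h1 : HasDerivAt (fun t : ℝ => (t * Complex.I : ℂ)) Complex.I t := by
      simpa using (hasDerivAt_id t).ofReal_comp.mul_const Complex.I
    rw [(h1.cexp.const_mul (Complex.I ^ n)).deriv]
    ring

theorem hasTemperateGrowth_exp_mul_I :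
    (fun t : ℝ => Complex.exp (t * Complex.I)).HasTemperateGrowth := by
  refine ⟨?_, fun n => ⟨0, 1, fun t => ?_⟩⟩
  · exact (Complex.ofRealCLM.contDiff.mul contDiff_const).cexp
  · rw [norm_iteratedFDeriv_eq_norm_iteratedDeriv, iteratedDeriv_exp_mul_I, norm_mul, norm_pow,
      Complex.norm_I, Complex.norm_exp_ofReal_mul_I]
    simp

variable {d : ℕ}

/-- The diagonal dilation `x ↦ (aᵢ xᵢ)ᵢ` of `ℝᵈ`. -/
def diagonalDilation (a : Fin d → ℝ) (ha : ∀ i, a i ≠ 0) :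
    EuclideanSpace ℝ (Fin d) ≃L[ℝ] EuclideanSpace ℝ (Fin d) :=
  LinearEquiv.toContinuousLinearEquiv
    { toFun := fun x => WithLp.toLp 2 fun i => a i * x i
      invFun := fun x => WithLp.toLp 2 fun i => (a i)⁻¹ * x i
      map_add' := fun x y => by
        ext i
        simp [mul_add]
      map_smul' := fun c x => by
        ext i
        simp [mul_left_comm]
      left_inv := fun x => by
        ext i
        simp [ha i]
      right_inv := fun x => by
        ext i
        simp [ha i] }

theorem diagonalDilation_apply (a : Fin d → ℝ) (ha : ∀ i, a i ≠ 0)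
    (x : EuclideanSpace ℝ (Fin d)) (i : Fin d) : diagonalDilation a ha x i = a i * x i :=
  rfl

theorem diagonalDilation_single (a : Fin d → ℝ) (ha : ∀ i, a i ≠ 0) (i : Fin d) :
    diagonalDilation a ha (EuclideanSpace.single i 1) = a i • EuclideanSpace.single i (1 : ℝ) := by
  ext j
  rw [diagonalDilation_apply]
  by_cases h : j = i
  · subst h
    simp
  · simp [h]

theorem hasTemperateGrowth_exp_coord_mul_I (k : Fin d) :
    (fun x : EuclideanSpace ℝ (Fin d) => Complex.exp (x k * Complex.I)).HasTemperateGrowth :=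
  hasTemperateGrowth_exp_mul_I.comp (f := fun x : EuclideanSpace ℝ (Fin d) => x k)
    (EuclideanSpace.proj k : EuclideanSpace ℝ (Fin d) →L[ℝ] ℝ).hasTemperateGrowth

/-- The wave packet `x ↦ e^(i xₖ) g(Dx)` with a diagonal dilation `D`. -/
def wavePacket (k : Fin d) (a : Fin d → ℝ) (ha : ∀ i, a i ≠ 0) :
    𝓢(EuclideanSpace ℝ (Fin d), ℂ) →L[ℂ] 𝓢(EuclideanSpace ℝ (Fin d), ℂ) :=
  SchwartzMap.smulLeftCLM ℂ (fun x : EuclideanSpace ℝ (Fin d) => Complex.exp (x k * Complex.I)) ∘L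
    SchwartzMap.compCLMOfContinuousLinearEquiv ℂ (diagonalDilation a ha)

theorem wavePacket_apply (k : Fin d) (a : Fin d → ℝ) (ha : ∀ i, a i ≠ 0)
    (g : 𝓢(EuclideanSpace ℝ (Fin d), ℂ)) (x : EuclideanSpace ℝ (Fin d)) :
    wavePacket k a ha g x = Complex.exp (x k * Complex.I) * g (diagonalDilation a ha x) := by
  rw [wavePacket, ContinuousLinearMap.comp_apply,
    SchwartzMap.smulLeftCLM_apply_apply (hasTemperateGrowth_exp_coord_mul_I k)]
  rfl

theorem lineDerivOp_wavePacket (k : Fin d) (a : Fin d → ℝ) (ha : ∀ i, a i ≠ 0)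
    (g : 𝓢(EuclideanSpace ℝ (Fin d), ℂ)) (i : Fin d) :
    ∂_{EuclideanSpace.single i (1 : ℝ)} (wavePacket k a ha g) =
      wavePacket k a ha ((if i = k then Complex.I else 0) • g +
        (a i : ℂ) • ∂_{EuclideanSpace.single i (1 : ℝ)} g) := by
  ext x
  have hx : HasFDerivAt (fun x : EuclideanSpace ℝ (Fin d) => x k)
      (EuclideanSpace.proj k : EuclideanSpace ℝ (Fin d) →L[ℝ] ℝ) x :=
    (EuclideanSpace.proj k : EuclideanSpace ℝ (Fin d) →L[ℝ] ℝ).hasFDerivAt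
  have h1 := ((Complex.ofRealCLM.hasFDerivAt.comp x hx).mul_const Complex.I).cexp
  have h2 := (g.hasFDerivAt (diagonalDilation a ha x)).comp x
    (diagonalDilation a ha).hasFDerivAt
  have h3 := h1.mul h2
  have h4 : (wavePacket k a ha g : EuclideanSpace ℝ (Fin d) → ℂ) =
      fun x => Complex.exp (x k * Complex.I) * g (diagonalDilation a ha x) :=
    funext (wavePacket_apply k a ha g)
  rw [SchwartzMap.lineDerivOp_apply_eq_fderiv, h4]
  refine (congrArg (fun L => L (EuclideanSpace.single i (1 : ℝ))) h3.fderiv).trans ?_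
  rw [wavePacket_apply]
  simp only [_root_.add_apply, _root_.smul_apply, ContinuousLinearMap.comp_apply,
    ContinuousLinearEquiv.coe_coe, diagonalDilation_single, map_smul,
    SchwartzMap.lineDerivOp_apply_eq_fderiv, Function.comp_apply, Complex.ofRealCLM_apply,
    smul_eq_mul, Complex.real_smul, PiLp.proj_apply]
  by_cases h : i = k
  · subst h
    simp
    ring
  · simp [h, Ne.symm h]

/-- The exponential contributes `-g` to the Laplacian, which cancels the 1 in `1 + iε`. The cross
term carries `a k = ε` and the second derivatives carry `a i ^ 2 = ε * b i`, so exactly one factor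
`ε` comes out. -/
theorem helmholtz_wavePacket (k : Fin d) {ε : ℝ} (a : Fin d → ℝ) (ha : ∀ i, a i ≠ 0)
    (b : Fin d → ℝ) (hk : a k = ε) (hab : ∀ i, a i ^ 2 = ε * b i)
    (g : 𝓢(EuclideanSpace ℝ (Fin d), ℂ)) :
    -Δ (wavePacket k a ha g) - (1 + ε * Complex.I : ℂ) • wavePacket k a ha g =
      -((ε : ℂ) • wavePacket k a ha ((2 * Complex.I) • ∂_{EuclideanSpace.single k (1 : ℝ)} g +
        Complex.I • g + ∑ i, (b i : ℂ) • ∂_{EuclideanSpace.single i (1 : ℝ)}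
          (∂_{EuclideanSpace.single i (1 : ℝ)} g))) := by
  have h1 : Δ (wavePacket k a ha g) = wavePacket k a ha (-g +
      (2 * ε * Complex.I) • ∂_{EuclideanSpace.single k (1 : ℝ)} g +
        (ε : ℂ) • ∑ i, (b i : ℂ) • ∂_{EuclideanSpace.single i (1 : ℝ)}
          (∂_{EuclideanSpace.single i (1 : ℝ)} g)) := by
    rw [SchwartzMap.laplacian_eq_sum (EuclideanSpace.basisFun (Fin d) ℝ)]
    simp only [EuclideanSpace.basisFun_apply, lineDerivOp_wavePacket]
    rw [← map_sum]
    congr 1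
    have h2 : ∀ i : Fin d, (if i = k then Complex.I else 0) •
        ((if i = k then Complex.I else 0) • g + (a i : ℂ) • ∂_{EuclideanSpace.single i (1 : ℝ)} g) +
        (a i : ℂ) • ∂_{EuclideanSpace.single i (1 : ℝ)} ((if i = k then Complex.I else 0) • g +
          (a i : ℂ) • ∂_{EuclideanSpace.single i (1 : ℝ)} g) =
        (if i = k then -g + (2 * ε * Complex.I) • ∂_{EuclideanSpace.single k (1 : ℝ)} g else 0) +
          (ε : ℂ) • (b i : ℂ) • ∂_{EuclideanSpace.single i (1 : ℝ)}
            (∂_{EuclideanSpace.single i (1 : ℝ)} g) := by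
      intro i
      have h3 : (a i : ℂ) * a i = ε * b i := by
        have := hab i
        rw [sq] at this
        exact_mod_cast this
      rw [lineDerivOp_add, lineDerivOp_smul, lineDerivOp_smul, smul_add (a i : ℂ), smul_smul _ (a i : ℂ),
        h3]
      by_cases h : i = k
      · subst h
        simp only [if_true, hk]
        have : Complex.I * Complex.I = -1 := Complex.I_mul_I
        rw [smul_add, smul_smul, this]
        module
      · simp only [h, if_false]
        module
    rw [Finset.sum_congr rfl fun i _ => h2 i, Finset.sum_add_distrib, Finset.sum_ite_eq',
      if_pos (Finset.mem_univ _), Finset.smul_sum]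
  rw [h1, ← map_smul, ← map_smul, ← map_neg, ← map_sub, ← map_neg]
  congr 1
  module

/-- The factor is the square root of the inverse Jacobian. It does not depend on `g`, so it drops
out when the error is compared with the packet. -/
theorem exists_norm_wavePacket_eq (k : Fin d) (a : Fin d → ℝ) (ha : ∀ i, a i ≠ 0) :
    ∃ c : ℝ, 0 < c ∧ ∀ g : 𝓢(EuclideanSpace ℝ (Fin d), ℂ),
      ‖((wavePacket k a ha g).toLp 2 : Lp ℂ 2 (volume : Measure (EuclideanSpace ℝ (Fin d))))‖ =
        c * ‖(g.toLp 2 : Lp ℂ 2 (volume : Measure (EuclideanSpace ℝ (Fin d))))‖ := by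
  set D := diagonalDilation a ha with hD
  have hdet : LinearMap.det (D.toLinearEquiv : EuclideanSpace ℝ (Fin d) →ₗ[ℝ] _) ≠ 0 :=
    D.toLinearEquiv.isUnit_det'.ne_zero
  set δ := |(LinearMap.det (D.toLinearEquiv : EuclideanSpace ℝ (Fin d) →ₗ[ℝ] _))⁻¹| with hδ
  have hδ0 : 0 < δ := abs_pos.2 (inv_ne_zero hdet)
  have hmap : Measure.map D (volume : Measure (EuclideanSpace ℝ (Fin d))) =
      ENNReal.ofReal δ • volume := Measure.map_linearMap_addHaar_eq_smul_addHaar _ hdet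
  have hsq : ∀ g : 𝓢(EuclideanSpace ℝ (Fin d), ℂ),
      ‖(g.toLp 2 : Lp ℂ 2 (volume : Measure (EuclideanSpace ℝ (Fin d))))‖ ^ 2 =
        ∫ x, ‖g x‖ ^ 2 := by
    intro g
    rw [norm_sq_eq_integral_norm_sq]
    refine integral_congr_ae ?_
    filter_upwards [g.coeFn_toLp 2] with x hx
    rw [hx]
  refine ⟨√δ, Real.sqrt_pos.2 hδ0, fun g => ?_⟩
  refine (sq_eq_sq₀ (norm_nonneg _) (by positivity)).1 ?_
  rw [mul_pow, Real.sq_sqrt hδ0.le, hsq, hsq]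
  have h1 : ∀ x, ‖wavePacket k a ha g x‖ ^ 2 = (fun y => ‖g y‖ ^ 2) (D x) := fun x => by
    rw [wavePacket_apply, norm_mul, Complex.norm_exp_ofReal_mul_I, one_mul]
  simp_rw [h1]
  rw [← integral_map (φ := D) (f := fun y => ‖g y‖ ^ 2) D.continuous.aemeasurable
    (by fun_prop), hmap, integral_smul_measure, ENNReal.toReal_ofReal hδ0.le, smul_eq_mul]

theorem diagonalDilation_mem_tube {ε : ℝ} (hε : 0 < ε) (a : Fin d → ℝ) (ha : ∀ i, a i ≠ 0)
    (ha0 : ∀ i : Fin d, i.val = 0 → a i = ε) (ha1 : ∀ i : Fin d, i.val ≠ 0 → a i = √ε)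
    {x : EuclideanSpace ℝ (Fin d)} (hx : ‖diagonalDilation a ha x‖ < 1) : x ∈ tube d ε := by
  have hsum : ∀ s : Finset (Fin d), √(∑ i ∈ s, (a i * x i) ^ 2) ≤ ‖diagonalDilation a ha x‖ := by
    intro s
    rw [EuclideanSpace.norm_eq]
    refine Real.sqrt_le_sqrt ?_
    refine (Finset.sum_le_univ_sum_of_nonneg fun i => sq_nonneg _).trans (le_of_eq ?_)
    simp [diagonalDilation_apply, mul_pow]
  refine ⟨fun i hi => ?_, ?_⟩
  · have h1 := (hsum {i}).trans_lt hx
    rw [Finset.sum_singleton, Real.sqrt_sq_eq_abs, ha0 i hi, abs_mul, abs_of_pos hε] at h1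
    rw [← one_div, lt_div_iff₀ hε]
    linarith
  · have h1 := (hsum {i : Fin d | i.val ≠ 0}).trans_lt hx
    have h2 : ∑ i : Fin d with i.val ≠ 0, (a i * x i) ^ 2 =
        ε * ∑ i : Fin d with i.val ≠ 0, x i ^ 2 := by
      rw [Finset.mul_sum]
      refine Finset.sum_congr rfl fun i hi => ?_
      rw [ha1 i (Finset.mem_filter.1 hi).2, mul_pow, Real.sq_sqrt hε.le]
    rw [h2, Real.sqrt_mul hε.le] at h1
    rw [Real.rpow_neg hε.le, ← Real.sqrt_eq_rpow, ← one_div, lt_div_iff₀ (Real.sqrt_pos.2 hε)]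
    linarith

theorem exists_schwartz_tsupport_subset_closedBall (E : Type*) [NormedAddCommGroup E]
    [InnerProductSpace ℝ E] [FiniteDimensional ℝ E] [MeasurableSpace E] [BorelSpace E] {r : ℝ}
    (hr : 0 < r) : ∃ g : 𝓢(E, ℂ), tsupport g ⊆ Metric.closedBall 0 r ∧
      (g.toLp 2 : Lp ℂ 2 (volume : Measure E)) ≠ 0 := by
  let β : ContDiffBump (0 : E) := ⟨r / 2, r, half_pos hr, half_lt_self hr⟩
  have hg₁ : HasCompactSupport (Complex.ofRealCLM ∘ β) := β.hasCompactSupport.comp_left rfl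
  have hg₂ := Complex.ofRealCLM.contDiff.comp (β.contDiff (n := (⊤ : ℕ∞)))
  refine ⟨hg₁.toSchwartzMap hg₂, ?_, fun h => ?_⟩
  · refine (closure_mono (Function.support_comp_subset (g := Complex.ofRealCLM) rfl β)).trans ?_
    exact β.tsupport_eq.subset
  · have h1 : hg₁.toSchwartzMap hg₂ = 0 := SchwartzMap.injective_toLp 2 volume (by
      dsimp only
      rw [h]
      exact (map_zero (SchwartzMap.toLpCLM ℂ (E := E) ℂ 2 volume)).symm)
    have h2 : hg₁.toSchwartzMap hg₂ 0 = 1 := by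
      change ((β 0 : ℝ) : ℂ) = 1
      rw [β.one_of_mem_closedBall (Metric.mem_closedBall_self β.rIn_pos.le), Complex.ofReal_one]
    rw [h1] at h2
    exact zero_ne_one h2

/-- Wave packets supported in the tube are approximate eigenfunctions of `-Δ` for the eigenvalue
`1 + iε`, with an error of order `ε`. -/
theorem exists_approximate_eigenfunction (hd : 0 < d) {M : ℝ} (hM : 0 < M) :
    ∃ C : ℝ, 0 < C ∧ ∀ ε : ℝ, 0 < ε → ε ≤ M → ∃ φ : 𝓢(EuclideanSpace ℝ (Fin d), ℂ),
      (φ.toLp 2 : Lp ℂ 2 (volume : Measure (EuclideanSpace ℝ (Fin d)))) ≠ 0 ∧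
      (∀ x ∉ tube d ε, φ x = 0) ∧
      (∀ x ∉ tube d ε, (-Δ φ - (1 + ε * Complex.I : ℂ) • φ) x = 0) ∧
      ‖((-Δ φ - (1 + ε * Complex.I : ℂ) • φ).toLp 2 :
        Lp ℂ 2 (volume : Measure (EuclideanSpace ℝ (Fin d))))‖ ≤
          C * ε * ‖(φ.toLp 2 : Lp ℂ 2 (volume : Measure (EuclideanSpace ℝ (Fin d))))‖ := by
  let k : Fin d := ⟨0, hd⟩
  -- Any radius below 1 would do: the preimage of the open unit ball under the dilation lies in the
  -- tube.
  obtain ⟨g, hgsupp, hg0⟩ := exists_schwartz_tsupport_subset_closedBall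
    (EuclideanSpace ℝ (Fin d)) (r := 1 / 2) (by norm_num)
  obtain ⟨N, hN⟩ : ∃ N : 𝓢(EuclideanSpace ℝ (Fin d), ℂ) → ℝ, ∀ h, N h =
    ‖(h.toLp 2 : Lp ℂ 2 (volume : Measure (EuclideanSpace ℝ (Fin d))))‖ := ⟨_, fun _ => rfl⟩
  have hN0 : ∀ h, 0 ≤ N h := fun h => by
    rw [hN]
    exact norm_nonneg _
  have hNg : 0 < N g := by
    rw [hN]
    exact norm_pos_iff.2 hg0
  obtain ⟨DD, hDD⟩ : ∃ DD : Fin d → 𝓢(EuclideanSpace ℝ (Fin d), ℂ), ∀ i, DD i =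
    ∂_{EuclideanSpace.single i (1 : ℝ)} (∂_{EuclideanSpace.single i (1 : ℝ)} g) :=
    ⟨_, fun _ => rfl⟩
  -- A bound for the error profile uniform in `ε ≤ M`: the coefficients `b i` are `ε` or 1, hence at
  -- most `M + 1`. The later `B + 1` only secures positivity.
  obtain ⟨B, hB⟩ : ∃ B : ℝ, B = N ((2 * Complex.I) • ∂_{EuclideanSpace.single k (1 : ℝ)} g + Complex.I • g) +
    ∑ i, (M + 1) * N (DD i) := ⟨_, rfl⟩
  have hB0 : 0 ≤ B := by
    rw [hB]
    exact add_nonneg (hN0 _) (Finset.sum_nonneg fun i _ => mul_nonneg (by linarith) (hN0 _))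
  refine ⟨(B + 1) / N g, by positivity, fun ε hε hεM => ?_⟩
  let a : Fin d → ℝ := fun i => if i.val = 0 then ε else √ε
  let b : Fin d → ℝ := fun i => if i.val = 0 then ε else 1
  have ha : ∀ i, a i ≠ 0 := fun i => by
    have := (Real.sqrt_pos.2 hε).ne'
    have := hε.ne'
    simp only [a]
    split_ifs <;> assumption
  have hab : ∀ i, a i ^ 2 = ε * b i := fun i => by
    simp only [a, b]
    split_ifs
    · ring
    · rw [Real.sq_sqrt hε.le, mul_one]
  have hak : a k = ε := by simp [a, k]
  obtain ⟨h, hh⟩ : ∃ h, h = (2 * Complex.I) • ∂_{EuclideanSpace.single k (1 : ℝ)} g +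
    Complex.I • g + ∑ i, (b i : ℂ) • DD i := ⟨_, rfl⟩
  have heq : -Δ (wavePacket k a ha g) - (1 + ε * Complex.I : ℂ) • wavePacket k a ha g =
      -((ε : ℂ) • wavePacket k a ha h) := by
    simp only [hh, hDD]
    exact helmholtz_wavePacket k a ha b hak hab g
  have hout : ∀ x ∉ tube d ε, diagonalDilation a ha x ∉ Metric.closedBall 0 (1 / 2) := by
    intro x hx h1
    rw [mem_closedBall_zero_iff] at h1
    refine hx (diagonalDilation_mem_tube hε a ha (fun i hi => by simp [a, hi])
      (fun i hi => by simp [a, hi]) (h1.trans_lt (by norm_num)))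
  have hzero : ∀ f : 𝓢(EuclideanSpace ℝ (Fin d), ℂ), tsupport f ⊆ Metric.closedBall 0 (1 / 2) →
      ∀ x ∉ tube d ε, f (diagonalDilation a ha x) = 0 := fun f hf x hx =>
    image_eq_zero_of_notMem_tsupport fun h1 => hout x hx (hf h1)
  have hd1 : ∀ i, tsupport (∂_{EuclideanSpace.single i (1 : ℝ)} g :
      𝓢(EuclideanSpace ℝ (Fin d), ℂ)) ⊆
      Metric.closedBall 0 (1 / 2) := fun i =>
    (SchwartzMap.tsupport_lineDerivOp_subset _ g).trans hgsupp
  have hd2 : ∀ i, tsupport (DD i) ⊆ Metric.closedBall 0 (1 / 2) := fun i => by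
    rw [hDD]
    exact (SchwartzMap.tsupport_lineDerivOp_subset _ _).trans (hd1 i)
  obtain ⟨c, hc, hcn⟩ := exists_norm_wavePacket_eq k a ha
  refine ⟨wavePacket k a ha g, ?_, fun x hx => ?_, fun x hx => ?_, ?_⟩
  · rw [← norm_pos_iff, hcn]
    positivity
  · rw [wavePacket_apply, hzero g hgsupp x hx, mul_zero]
  · rw [heq, _root_.neg_apply, _root_.smul_apply, wavePacket_apply, hh]
    simp only [_root_.add_apply, _root_.smul_apply, _root_.sum_apply,
      hzero g hgsupp x hx, hzero _ (hd1 k) x hx, hzero _ (hd2 _) x hx]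
    simp
  · have hNh : N h ≤ B := by
      have hlin : ∀ f : 𝓢(EuclideanSpace ℝ (Fin d), ℂ), N f =
        ‖SchwartzMap.toLpCLM ℂ (E := EuclideanSpace ℝ (Fin d)) ℂ 2 volume f‖ := hN
      rw [hh, hB, hlin, map_add, map_sum]
      refine (norm_add_le _ _).trans (add_le_add (hlin _).ge ((norm_sum_le _ _).trans ?_))
      refine Finset.sum_le_sum fun i _ => ?_
      rw [map_smul, norm_smul, ← hlin]
      refine mul_le_mul_of_nonneg_right ?_ (hN0 _)
      · rw [Complex.norm_real, Real.norm_eq_abs]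
        simp only [b]
        split_ifs
        · rw [abs_of_pos hε]
          linarith
        · rw [abs_one]
          linarith
    have h1 : ‖((-Δ (wavePacket k a ha g) - (1 + ε * Complex.I : ℂ) • wavePacket k a ha g).toLp 2 :
        Lp ℂ 2 (volume : Measure (EuclideanSpace ℝ (Fin d))))‖ = ε * (c * N h) := by
      rw [heq, ← map_smul, ← map_neg, hcn, ← SchwartzMap.toLpCLM_apply (𝕜 := ℂ), map_neg, map_smul,
        norm_neg, norm_smul, Complex.norm_real, Real.norm_of_nonneg hε.le,
        SchwartzMap.toLpCLM_apply, hN]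
      ring
    rw [h1, hcn, ← hN]
    calc ε * (c * N h) ≤ ε * (c * (B + 1)) := by
          gcongr
          linarith
      _ = (B + 1) / N g * ε * (c * N g) := by
          field_simp

end WavePacket

/-! ### Topology and volume of the tube. -/

section Tube

variable {d : ℕ}

theorem isOpen_tube (d : ℕ) (ε : ℝ) : IsOpen (tube d ε) := by
  have h : tube d ε = (⋂ i : Fin d, ⋂ _ : i.val = 0, {x | |x i| < ε⁻¹}) ∩
      {x | √(∑ i : Fin d with i.val ≠ 0, x i ^ 2) < ε ^ (-(1 / 2) : ℝ)} := by
    ext x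
    simp [tube]
  rw [h]
  refine (isOpen_iInter_of_finite fun i => isOpen_iInter_of_finite fun _ => ?_).inter ?_
  · exact isOpen_lt (by fun_prop) continuous_const
  · exact isOpen_lt (by fun_prop) continuous_const

theorem volume_tube_pos {ε : ℝ} (hε : 0 < ε) : 0 < volume (tube d ε) := by
  refine (isOpen_tube d ε).measure_pos volume ⟨0, fun i _ => ?_, ?_⟩
  · simpa using hε
  · simpa using Real.rpow_pos_of_pos hε _

/-- The tube sits in a box with one side `2ε⁻¹` and `d - 1` sides `2ε^(-1/2)`; the exponents add up
to `-(1 + (d - 1)/2)`. -/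
theorem volume_tube_le (hd : 0 < d) {ε : ℝ} (hε : 0 < ε) :
    volume (tube d ε) ≤ ENNReal.ofReal (2 ^ d * ε ^ (-(((d : ℝ) + 1) / 2))) := by
  let w : Fin d → ℝ := fun i => if i.val = 0 then ε⁻¹ else ε ^ (-(1 / 2) : ℝ)
  have hw : ∀ i, 0 < w i := fun i => by
    simp only [w]
    split_ifs
    · exact inv_pos.2 hε
    · exact Real.rpow_pos_of_pos hε _
  have hsub : tube d ε ⊆ WithLp.ofLp ⁻¹' (Set.univ.pi fun i => Set.Ioo (-w i) (w i)) := by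
    rintro x ⟨h0, h1⟩ i -
    rw [Set.mem_Ioo, ← abs_lt]
    by_cases hi : i.val = 0
    · simpa [w, hi] using h0 i hi
    · simp only [w, hi, if_false]
      refine lt_of_le_of_lt ?_ h1
      rw [← Real.sqrt_sq_eq_abs]
      refine Real.sqrt_le_sqrt ?_
      exact Finset.single_le_sum (f := fun i => x i ^ 2) (fun j _ => sq_nonneg _)
        (Finset.mem_filter.2 ⟨Finset.mem_univ _, hi⟩)
  refine (measure_mono hsub).trans ?_
  rw [(PiLp.volume_preserving_ofLp (Fin d)).measure_preimage
    (MeasurableSet.univ_pi fun i => measurableSet_Ioo).nullMeasurableSet, Real.volume_pi_Ioo,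
    ← ENNReal.ofReal_prod_of_nonneg fun i _ => by linarith [hw i]]
  refine ENNReal.ofReal_le_ofReal (le_of_eq ?_)
  obtain ⟨n, rfl⟩ : ∃ n, d = n + 1 := ⟨d - 1, by omega⟩
  have h2 : ∀ i, w i - -w i = 2 * w i := fun i => by ring
  simp_rw [h2]
  rw [Finset.prod_mul_distrib, Finset.prod_const, Finset.card_univ, Fintype.card_fin,
    Fin.prod_univ_succ]
  congr 1
  simp only [w, Fin.val_zero, if_true, Fin.val_succ, Nat.succ_ne_zero, if_false,
    Finset.prod_const, Finset.card_univ, Fintype.card_fin]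
  rw [← Real.rpow_neg_one, ← Real.rpow_natCast, ← Real.rpow_mul hε.le, ← Real.rpow_add hε]
  congr 1
  push_cast
  ring

end Tube

/-! ### From the compressed resolvent to potentials with a prescribed eigenvalue. -/

section Eigenvalue

variable {d : ℕ}

/-- Birman–Schwinger: with `ψ = (-Δ - z)⁻¹ f`, the relation `Vψ = -f` is the eigenvalue equation. -/
theorem isSchrodingerEigenvalue_of_mul_freeResolvent_eq_neg {z : ℂ} (hz : z.im ≠ 0)
    (V : EuclideanSpace ℝ (Fin d) → ℂ)
    (f : Lp ℂ 2 (volume : Measure (EuclideanSpace ℝ (Fin d))))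
    (hf : freeResolvent (EuclideanSpace ℝ (Fin d)) hz f ≠ 0)
    (hV : (fun x => V x * freeResolvent (EuclideanSpace ℝ (Fin d)) hz f x) =ᵐ[volume]
      fun x => -f x) : IsSchrodingerEigenvalue V z := by
  obtain ⟨ψ, hψ⟩ : ∃ ψ, ψ = freeResolvent (EuclideanSpace ℝ (Fin d)) hz f := ⟨_, rfl⟩
  rw [← hψ] at hf hV
  have h1 : ψ ∈ sobolevH2 d := by
    rw [hψ]
    exact memSobolev_freeResolvent hz f
  have h2 : ψ ∈ mulDomain V := (memLp_congr_ae hV).2 (Lp.memLp f).neg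
  refine ⟨⟨ψ, h1, h2⟩, fun h => hf (congrArg Subtype.val h), ?_⟩
  have h3 : negLaplacian d ⟨ψ, h1⟩ = z • ψ + f := by
    apply toTemperedDistribution_injective
    have h4 : (negLaplacian d ⟨ψ, h1⟩ : 𝓢'(EuclideanSpace ℝ (Fin d), ℂ)) =
      -Δ (ψ : 𝓢'(EuclideanSpace ℝ (Fin d), ℂ)) := (exists_neg_laplacian ⟨ψ, h1⟩).choose_spec
    have h5 := neg_laplacian_freeResolvent hz f
    rw [← hψ] at h5
    rw [h4, ← Lp.toTemperedDistributionCLM_apply (z • ψ + f), map_add, map_smul,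
      Lp.toTemperedDistributionCLM_apply, Lp.toTemperedDistributionCLM_apply, ← h5]
    abel
  have h6 : mulPotential V ⟨ψ, h2⟩ = -f := by
    apply Lp.ext
    filter_upwards [MemLp.coeFn_toLp (memLp_of_mem_mulDomain h2), hV, Lp.coeFn_neg f]
      with x h7 h8 h9
    rw [h9, Pi.neg_apply, ← h8, ← h7]
    rfl
  change negLaplacian d ⟨ψ, h1⟩ + mulPotential V ⟨ψ, h2⟩ = z • ψ
  rw [h3, h6, add_neg_cancel_right]

/-- The free resolvent compressed to a measurable set. -/
def compressedResolvent {E : Type*} [NormedAddCommGroup E] [InnerProductSpace ℝ E]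
    [FiniteDimensional ℝ E] [MeasurableSpace E] [BorelSpace E] {z : ℂ} (hz : z.im ≠ 0)
    {s : Set E} (hs : MeasurableSet s) :
    Lp ℂ 2 (volume : Measure E) →L[ℂ] Lp ℂ 2 (volume : Measure E) :=
  cutoff volume hs ∘L freeResolvent E hz ∘L cutoff volume hs

theorem star_Lp_add {α : Type*} [MeasurableSpace α] {μ : Measure α} (f g : Lp ℂ 2 μ) :
    star (f + g) = star f + star g := by
  apply Lp.ext
  filter_upwards [Lp.coeFn_star (f + g), Lp.coeFn_add f g, Lp.coeFn_star f, Lp.coeFn_star g,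
    Lp.coeFn_add (star f) (star g)] with x h1 h2 h3 h4 h5
  rw [h1, Pi.star_apply, h5, h2, Pi.add_apply, Pi.add_apply, h3, h4, Pi.star_apply, Pi.star_apply, star_add]

theorem star_Lp_smul {α : Type*} [MeasurableSpace α] {μ : Measure α} (c : ℂ) (f : Lp ℂ 2 μ) :
    star (c • f) = (starRingEnd ℂ c) • star f := by
  apply Lp.ext
  filter_upwards [Lp.coeFn_star (c • f), Lp.coeFn_smul c f, Lp.coeFn_star f,
    Lp.coeFn_smul (starRingEnd ℂ c) (star f)] with x h1 h2 h3 h4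
  rw [h1, Pi.star_apply, h4, h2, Pi.smul_apply, Pi.smul_apply, h3, Pi.star_apply, star_smul]
  rfl

/-- A set of finite measure on which the compressed resolvent does not vanish supports a potential
whose modulus is the inverse norm of the compressed resolvent and which has eigenvalue `z`. -/
theorem exists_potential_of_compressedResolvent_ne_zero {z : ℂ} (hz : z.im ≠ 0)
    {s : Set (EuclideanSpace ℝ (Fin d))} (hs : MeasurableSet s) (hμs : volume s ≠ ∞)
    (hK : compressedResolvent hz hs ≠ 0) :
    ∃ V : EuclideanSpace ℝ (Fin d) → ℂ, Measurable V ∧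
      (∀ x, ‖V x‖ = s.indicator (fun _ => ‖compressedResolvent hz hs‖⁻¹) x) ∧
      IsSchrodingerEigenvalue V z := by
  have hσ : 0 < ‖compressedResolvent hz hs‖ := norm_pos_iff.2 hK
  obtain ⟨f, hf0, hf⟩ := exists_apply_eq_norm_smul_conj (star : Lp ℂ 2 volume → Lp ℂ 2 volume)
    star_Lp_add star_Lp_smul star_star (compressedResolvent hz hs)
    (isCompactOperator_cutoff_freeResolvent_cutoff hz hs hμs) hK fun x y => by
      simp only [compressedResolvent, ContinuousLinearMap.comp_apply, cutoff]
      rw [inner_star_mulLp, inner_star_freeResolvent, inner_star_mulLp]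
  generalize ‖compressedResolvent hz hs‖ = σ at hσ hf
  have hσ' : (σ : ℂ) ≠ 0 := Complex.ofReal_ne_zero.2 hσ.ne'
  obtain ⟨ψ, hψ⟩ : ∃ ψ, ψ = freeResolvent (EuclideanSpace ℝ (Fin d)) hz f := ⟨_, rfl⟩
  -- `f` is a multiple of the conjugate of `K f`, and the range of `K` consists of functions
  -- supported in `s`.
  have hfs : f =ᵐ[volume] s.indicator f := by
    have h1 : f = (σ : ℂ)⁻¹ • star (compressedResolvent hz hs f) := by
      rw [hf, star_Lp_smul, star_star, Complex.conj_ofReal, inv_smul_smul₀ hσ']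
    have h2 : ∀ᵐ x, f x = (σ : ℂ)⁻¹ * star (compressedResolvent hz hs f x) := by
      have h3 := Lp.coeFn_smul (σ : ℂ)⁻¹ (star (compressedResolvent hz hs f))
      rw [← h1] at h3
      filter_upwards [h3, Lp.coeFn_star (compressedResolvent hz hs f)] with x h3 h4
      rw [h3, Pi.smul_apply, h4, Pi.star_apply, smul_eq_mul]
    filter_upwards [h2, coeFn_cutoff hs (freeResolvent (EuclideanSpace ℝ (Fin d)) hz
      (cutoff volume hs f))] with x h3 h4
    by_cases hx : x ∈ s
    · rw [Set.indicator_of_mem hx]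
    · rw [Set.indicator_of_notMem hx, h3, compressedResolvent, ContinuousLinearMap.comp_apply,
        ContinuousLinearMap.comp_apply, h4, Set.indicator_of_notMem hx, star_zero, mul_zero]
  have hcut : cutoff volume hs f = f := Lp.ext ((coeFn_cutoff hs f).trans hfs.symm)
  have hKf : cutoff volume hs ψ = (σ : ℂ) • star f := by
    rw [← hf, compressedResolvent, ContinuousLinearMap.comp_apply, ContinuousLinearMap.comp_apply,
      hcut, hψ]
  have hψ0 : ψ ≠ 0 := by
    rintro rfl
    rw [map_zero] at hKf
    have h1 := (smul_eq_zero.1 hKf.symm).resolve_left hσ'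
    apply hf0
    have h2 : star (0 : Lp ℂ 2 (volume : Measure (EuclideanSpace ℝ (Fin d)))) = 0 := by
      simpa using star_Lp_smul 0 (0 : Lp ℂ 2 (volume : Measure (EuclideanSpace ℝ (Fin d))))
    rw [← star_star f, h1, h2]
  have hfm : Measurable f := (Lp.stronglyMeasurable f).measurable
  -- On `s` one has `ψ = σ f̄`, so the quotient is forced where `f ≠ 0`. Where `f = 0` also `ψ = 0`,
  -- and the value `σ⁻¹` is chosen to keep the modulus constant.
  set V : EuclideanSpace ℝ (Fin d) → ℂ := s.indicator fun x =>
    if f x = 0 then (σ : ℂ)⁻¹ else -(f x / (σ * starRingEnd ℂ (f x))) with hV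
  refine ⟨V, ?_, fun x => ?_, ?_⟩
  · refine Measurable.indicator (Measurable.ite (hfm (measurableSet_singleton 0)) measurable_const
      ?_) hs
    exact (hfm.div (measurable_const.mul
      (Complex.continuous_conj.measurable.comp hfm))).neg
  · by_cases hx : x ∈ s
    · rw [hV, Set.indicator_of_mem hx, Set.indicator_of_mem hx]
      by_cases h : f x = 0
      · rw [if_pos h, norm_inv, Complex.norm_real, Real.norm_of_nonneg hσ.le]
      · rw [if_neg h, norm_neg, norm_div, norm_mul, RCLike.norm_conj, Complex.norm_real,
          Real.norm_of_nonneg hσ.le]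
        have := norm_ne_zero_iff.2 h
        field_simp
    · rw [hV, Set.indicator_of_notMem hx, Set.indicator_of_notMem hx, norm_zero]
  · refine isSchrodingerEigenvalue_of_mul_freeResolvent_eq_neg hz V f (hψ ▸ hψ0) ?_
    rw [← hψ]
    have h1 := coeFn_cutoff hs ψ
    rw [hKf] at h1
    filter_upwards [h1, Lp.coeFn_smul (σ : ℂ) (star f), Lp.coeFn_star f, hfs] with x h2 h3 h4 h5
    by_cases hx : x ∈ s
    · rw [Set.indicator_of_mem hx, h3, Pi.smul_apply, h4, Pi.star_apply, smul_eq_mul,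
        RCLike.star_def] at h2
      rw [hV, Set.indicator_of_mem hx, ← h2]
      by_cases h : f x = 0
      · simp [h]
      · have h' : starRingEnd ℂ (f x) ≠ 0 := (map_ne_zero _).2 h
        rw [if_neg h]
        field_simp
    · rw [hV, Set.indicator_of_notMem hx, zero_mul, h5, Set.indicator_of_notMem hx, neg_zero]

theorem im_one_add_mul_I_ne_zero {ε : ℝ} (hε : 0 < ε) : (1 + ε * Complex.I : ℂ).im ≠ 0 := by
  simpa using hε.ne'

/-- The resolvent at `1 + iε` compressed to the tube has norm at least of order `ε⁻¹`. -/
theorem exists_one_le_mul_norm_compressedResolvent_tube (hd : 0 < d) {M : ℝ} (hM : 0 < M) :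
    ∃ C : ℝ, 0 < C ∧ ∀ (ε : ℝ) (hε : 0 < ε), ε ≤ M →
      1 ≤ C * ε * ‖compressedResolvent (im_one_add_mul_I_ne_zero hε)
        (isOpen_tube d ε).measurableSet‖ := by
  obtain ⟨C, hC, h⟩ := exists_approximate_eigenfunction hd hM
  refine ⟨C, hC, fun ε hε hεM => ?_⟩
  obtain ⟨φ, hφ0, hφ, hφ', hle⟩ := h ε hε hεM
  have hs := (isOpen_tube d ε).measurableSet
  have hcut : ∀ χ : 𝓢(EuclideanSpace ℝ (Fin d), ℂ), (∀ x ∉ tube d ε, χ x = 0) →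
      cutoff volume hs (χ.toLp 2) = χ.toLp 2 := fun χ hχ => by
    apply Lp.ext
    filter_upwards [coeFn_cutoff hs (χ.toLp 2), χ.coeFn_toLp 2] with x h1 h2
    rw [h1]
    by_cases hx : x ∈ tube d ε
    · rw [Set.indicator_of_mem hx]
    · rw [Set.indicator_of_notMem hx, h2, hχ x hx]
  have h1 : compressedResolvent (im_one_add_mul_I_ne_zero hε) hs
      ((-Δ φ - (1 + ε * Complex.I : ℂ) • φ).toLp 2) = φ.toLp 2 := by
    rw [compressedResolvent, ContinuousLinearMap.comp_apply, ContinuousLinearMap.comp_apply,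
      hcut _ hφ', freeResolvent_helmholtz, hcut _ hφ]
  have h2 := (compressedResolvent (im_one_add_mul_I_ne_zero hε) hs).le_opNorm
    ((-Δ φ - (1 + ε * Complex.I : ℂ) • φ).toLp 2)
  rw [h1] at h2
  have h3 := norm_pos_iff.2 hφ0
  have h4 := h2.trans (mul_le_mul_of_nonneg_left hle (norm_nonneg _))
  refine le_of_mul_le_mul_right ?_ h3
  linarith

end Eigenvalue

/-! ### The family of potentials and its `L^q` norms. -/

section Counterexample

variable {d : ℕ}

/-- Potentials of size `O(ε)` supported in the tube with eigenvalue `1 + iε`. -/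
theorem exists_potentials_tube (hd : 0 < d) :
    ∃ (V : ℝ → EuclideanSpace ℝ (Fin d) → ℂ) (κ : ℝ → ℝ),
      (∀ ε, 0 < ε → Measurable (V ε)) ∧ (∀ ε, 0 < ε → 0 < κ ε) ∧
      (∀ ε, 0 < ε → ∀ x, ‖V ε x‖ = (tube d ε).indicator (fun _ => κ ε) x) ∧
      (∀ ε : ℝ, 0 < ε → IsSchrodingerEigenvalue (V ε) (1 + ε * Complex.I)) ∧
      ∀ M : ℝ, 0 < M → ∃ C : ℝ, 0 < C ∧ ∀ ε : ℝ, 0 < ε → ε ≤ M → κ ε ≤ C * ε := by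
  have hpos : ∀ (ε : ℝ) (hε : 0 < ε), 0 < ‖compressedResolvent (im_one_add_mul_I_ne_zero hε)
      (isOpen_tube d ε).measurableSet‖ := fun ε hε => by
    obtain ⟨C, hC, h⟩ := exists_one_le_mul_norm_compressedResolvent_tube hd hε
    exact pos_of_mul_pos_right (one_pos.trans_le (h ε hε le_rfl)) (by positivity)
  -- Positivity of `ε` is placed inside the existential so that the choice yields functions on all
  -- of `ℝ`, independent of `M`.
  have hex : ∀ ε : ℝ, ∃ (V : EuclideanSpace ℝ (Fin d) → ℂ) (κ : ℝ), ∀ hε : 0 < ε,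
      Measurable V ∧ κ = ‖compressedResolvent (im_one_add_mul_I_ne_zero hε)
        (isOpen_tube d ε).measurableSet‖⁻¹ ∧ (∀ x, ‖V x‖ = (tube d ε).indicator (fun _ => κ) x) ∧
        IsSchrodingerEigenvalue V (1 + ε * Complex.I) := by
    intro ε
    by_cases hε : 0 < ε
    · obtain ⟨V, hV1, hV2, hV3⟩ := exists_potential_of_compressedResolvent_ne_zero
        (im_one_add_mul_I_ne_zero hε) (isOpen_tube d ε).measurableSet
        ((volume_tube_le hd hε).trans_lt ENNReal.ofReal_lt_top).ne (norm_pos_iff.1 (hpos ε hε))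
      exact ⟨V, _, fun _ => ⟨hV1, rfl, hV2, hV3⟩⟩
    · exact ⟨0, 0, fun h => absurd h hε⟩
  choose V κ h using hex
  refine ⟨V, κ, fun ε hε => (h ε hε).1, fun ε hε => ?_, fun ε hε => (h ε hε).2.2.1,
    fun ε hε => (h ε hε).2.2.2, fun M hM => ?_⟩
  · rw [(h ε hε).2.1]
    exact inv_pos.2 (hpos ε hε)
  · obtain ⟨C, hC, hle⟩ := exists_one_le_mul_norm_compressedResolvent_tube hd hM
    refine ⟨C, hC, fun ε hε hεM => ?_⟩
    rw [(h ε hε).2.1, inv_le_iff_one_le_mul₀ (hpos ε hε)]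
    exact hle ε hε hεM

theorem norm_rpow_eq_indicator {α : Type*} {s : Set α} {V : α → ℂ} {κ q : ℝ} (hq : 0 < q)
    (hV : ∀ x, ‖V x‖ = s.indicator (fun _ => κ) x) :
    (fun x => ‖V x‖ ^ q) = s.indicator fun _ => κ ^ q := by
  ext x
  rw [hV]
  by_cases hx : x ∈ s <;> simp [hx, Real.zero_rpow hq.ne']

theorem integral_norm_rpow_pos (hd : 0 < d) {ε : ℝ} (hε : 0 < ε)
    {V : EuclideanSpace ℝ (Fin d) → ℂ} {κ q : ℝ} (hq : 0 < q) (hκ : 0 < κ)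
    (hV : ∀ x, ‖V x‖ = (tube d ε).indicator (fun _ => κ) x) : 0 < ∫ x, ‖V x‖ ^ q := by
  rw [norm_rpow_eq_indicator hq hV, integral_indicator (isOpen_tube d ε).measurableSet,
    setIntegral_const, smul_eq_mul]
  refine mul_pos ?_ (Real.rpow_pos_of_pos hκ _)
  exact ENNReal.toReal_pos (volume_tube_pos hε).ne'
    ((volume_tube_le hd hε).trans_lt ENNReal.ofReal_lt_top).ne

theorem integral_norm_rpow_le (hd : 0 < d) {ε : ℝ} (hε : 0 < ε)
    {V : EuclideanSpace ℝ (Fin d) → ℂ} {κ q C : ℝ} (hq : 0 < q) (hκ : 0 < κ) (hC : 0 < C)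
    (hκC : κ ≤ C * ε) (hV : ∀ x, ‖V x‖ = (tube d ε).indicator (fun _ => κ) x) :
    ∫ x, ‖V x‖ ^ q ≤ 2 ^ d * C ^ q * ε ^ (q - ((d : ℝ) + 1) / 2) := by
  rw [norm_rpow_eq_indicator hq hV, integral_indicator (isOpen_tube d ε).measurableSet,
    setIntegral_const, smul_eq_mul]
  have h1 : volume.real (tube d ε) ≤ 2 ^ d * ε ^ (-(((d : ℝ) + 1) / 2)) :=
    ENNReal.toReal_le_of_le_ofReal (by positivity) (volume_tube_le hd hε)
  calc volume.real (tube d ε) * κ ^ q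
      ≤ (2 ^ d * ε ^ (-(((d : ℝ) + 1) / 2))) * (C * ε) ^ q := by gcongr
    _ = 2 ^ d * C ^ q * ε ^ (q - ((d : ℝ) + 1) / 2) := by
        rw [Real.mul_rpow hC.le hε.le, sub_eq_add_neg, Real.rpow_add hε]
        ring

/-- The exponent `q - (d + 1)/2` is positive. The one-sided target filter records strict positivity
of the integrals, so that their reciprocals tend to infinity. -/
theorem tendsto_integral_norm_rpow (hd : 0 < d) {V : ℝ → EuclideanSpace ℝ (Fin d) → ℂ}
    {κ : ℝ → ℝ} (hκ : ∀ ε, 0 < ε → 0 < κ ε)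
    (hV : ∀ ε, 0 < ε → ∀ x, ‖V ε x‖ = (tube d ε).indicator (fun _ => κ ε) x)
    (hC : ∀ M : ℝ, 0 < M → ∃ C : ℝ, 0 < C ∧ ∀ ε : ℝ, 0 < ε → ε ≤ M → κ ε ≤ C * ε)
    {q : ℝ} (hq : ((d : ℝ) + 1) / 2 < q) :
    Tendsto (fun ε => ∫ x, ‖V ε x‖ ^ q) (𝓝[>] 0) (𝓝[>] 0) := by
  have hq0 : 0 < q := lt_trans (by positivity) hq
  obtain ⟨C, hC0, hCle⟩ := hC 1 one_pos
  have hmem : ∀ᶠ ε : ℝ in 𝓝[>] 0, 0 < ε ∧ ε ≤ 1 := by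
    filter_upwards [Ioc_mem_nhdsGT (zero_lt_one' ℝ)] with ε hε using hε
  refine tendsto_nhdsWithin_iff.2 ⟨?_, ?_⟩
  · have hlim : Tendsto (fun ε : ℝ => 2 ^ d * C ^ q * ε ^ (q - ((d : ℝ) + 1) / 2)) (𝓝[>] 0)
        (𝓝 0) := by
      have h1 : ContinuousAt (fun ε : ℝ => 2 ^ d * C ^ q * ε ^ (q - ((d : ℝ) + 1) / 2)) 0 :=
        continuousAt_const.mul (Real.continuousAt_rpow_const _ _ (Or.inr (sub_pos.2 hq).le))
      have h2 := h1.tendsto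
      simp only [Real.zero_rpow (sub_pos.2 hq).ne', mul_zero] at h2
      exact h2.mono_left nhdsWithin_le_nhds
    refine tendsto_of_tendsto_of_tendsto_of_le_of_le' tendsto_const_nhds hlim ?_ ?_
    · filter_upwards [hmem] with ε hε
      exact (integral_norm_rpow_pos hd hε.1 hq0 (hκ ε hε.1) (hV ε hε.1)).le
    · filter_upwards [hmem] with ε hε
      exact integral_norm_rpow_le hd hε.1 hq0 (hκ ε hε.1) hC0 (hCle ε hε.1 hε.2) (hV ε hε.1)
  · filter_upwards [hmem] with ε hε
    exact integral_norm_rpow_pos hd hε.1 hq0 (hκ ε hε.1) (hV ε hε.1)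

theorem one_le_norm_one_add_mul_I (ε : ℝ) : 1 ≤ ‖(1 + ε * Complex.I : ℂ)‖ := by
  refine le_trans ?_ (Complex.abs_re_le_norm _)
  simp

theorem memLp_of_norm_eq_indicator {α : Type*} [MeasurableSpace α] {μ : Measure α} {s : Set α}
    (hs : MeasurableSet s) (hμs : μ s ≠ ∞) {V : α → ℂ} (hVm : Measurable V) {κ : ℝ}
    (hV : ∀ x, ‖V x‖ = s.indicator (fun _ => κ) x) (p : ℝ≥0∞) : MemLp V p μ := by
  refine (memLp_indicator_const p hs κ (Or.inr hμs)).of_le hVm.aestronglyMeasurable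
    (Eventually.of_forall fun x => ?_)
  rw [hV]
  exact le_abs_self _

end Counterexample

end

/-! ### Both claims from the single family of potentials. -/

theorem theorem1 (d : ℕ) (hd : 2 ≤ d) :
    (∃ V : ℝ → EuclideanSpace ℝ (Fin d) → ℂ,
      (∀ ε : ℝ, 0 < ε → Measurable (V ε)) ∧
      (∀ M : ℝ, 0 < M → ∃ C : ℝ, 0 < C ∧ ∀ ε : ℝ, 0 < ε → ε ≤ M →
        ∀ x : EuclideanSpace ℝ (Fin d),
          ‖V ε x‖ ≤ C * ε * (tube d ε).indicator (fun _ => (1 : ℝ)) x) ∧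
      (∀ ε : ℝ, 0 < ε → IsSchrodingerEigenvalue (V ε) (1 + ε * Complex.I)) ∧
      ∀ q : ℝ, ((d : ℝ) + 1) / 2 < q →
        limsup (fun ε : ℝ =>
          ((‖(1 + ε * Complex.I : ℂ)‖ ^ (q - (d : ℝ) / 2) / ∫ x, ‖V ε x‖ ^ q : ℝ) : EReal))
          (𝓝[>] 0) = ⊤) ∧
    (∀ γ : ℝ, 1 / 2 < γ → ¬ LaptevSafronovBound d γ) := by
  have hd0 : 0 < d := by omega
  obtain ⟨V, κ, hVm, hκ, hV, hVe, hκC⟩ := exists_potentials_tube hd0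
  refine ⟨⟨V, hVm, fun M hM => ?_, hVe, fun q hq => ?_⟩, fun γ hγ ⟨D, hD⟩ => ?_⟩
  · obtain ⟨C, hC, hle⟩ := hκC M hM
    refine ⟨C, hC, fun ε hε hεM x => ?_⟩
    rw [hV ε hε]
    by_cases hx : x ∈ tube d ε
    · simpa [hx] using hle ε hε hεM
    · simp [hx]
  -- The full limit exists: the numerator is at least 1, so the quotient dominates the reciprocal of
  -- the integral.
  · refine Tendsto.limsup_eq (EReal.tendsto_coe_nhds_top_iff.2 ?_)
    have hlim := tendsto_integral_norm_rpow hd0 hκ hV hκC hq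
    refine tendsto_atTop_mono' _ ?_ (tendsto_inv_nhdsGT_zero.comp hlim)
    filter_upwards [hlim.eventually self_mem_nhdsWithin] with ε hε
    have hε' : 0 < ∫ x, ‖V ε x‖ ^ q := hε
    rw [Function.comp_apply, inv_eq_one_div]
    gcongr
    exact Real.one_le_rpow (one_le_norm_one_add_mul_I ε) (by linarith)
  -- The condition `γ > 1/2` is exactly `q > (d + 1)/2` for `q = γ + d/2`. For small `ε` the right
  -- side of the bound is below 1 while `|z|^γ ≥ 1`.
  · have hq : ((d : ℝ) + 1) / 2 < γ + d / 2 := by linarith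
    have hlim := tendsto_integral_norm_rpow hd0 hκ hV hκC hq
    have h1 : Tendsto (fun ε => D * ∫ x, ‖V ε x‖ ^ (γ + d / 2)) (𝓝[>] 0) (𝓝 0) := by
      simpa using (hlim.mono_right nhdsWithin_le_nhds).const_mul D
    obtain ⟨ε, hlt, hε⟩ := ((h1.eventually_lt_const one_pos).and self_mem_nhdsWithin).exists
    replace hε : 0 < ε := hε
    have hmem := memLp_of_norm_eq_indicator (isOpen_tube d ε).measurableSet
      ((volume_tube_le hd0 hε).trans_lt ENNReal.ofReal_lt_top).ne (hVm ε hε) (hV ε hε)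
    have h2 := hD (V ε) (1 + ε * Complex.I) (hmem _) (hmem _) (fun r _ h => by
      apply im_one_add_mul_I_ne_zero hε
      rw [h, Complex.ofReal_im]) (hVe ε hε)
    have h3 := Real.one_le_rpow (one_le_norm_one_add_mul_I ε) (by linarith : 0 ≤ γ)
    linarith
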